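/- Let $H$ be a finite-dimensional real Lie group with identity $e$, Lie algebra $\mathfrak h=T_eH$ (bracket of left-invariant vector fields) and dual $\mathfrak h^*$. Let $(P,\omega_P)$ be a finite-dimensional symplectic manifold on which $H$ acts smoothly from the left, preserving $\omega_P$. Let $B$ be a smooth closed two-form on $H\times P$ that is invariant under the diagonal action $h\cdot(g,p)=(hg,h\cdot p)$ and whose restriction to each slice $\{g\}\times P$ is $-\omega_P$. Let $\phi:H\times P\to\mathfrak h^*$ be a smooth map with $\mathbf i_{\xi_{H\times P}}B=\mathbf d\langle\phi,\xi\rangle$ for all $\xi\in\mathfrak h$, where $\xi_{H\times P}$ is the fundamental vector field of $\xi$ for the diagonal action. On $T^*H\times P$ consider $\Omega=\omega_{\rm can}-B$, where $\omega_{\rm can}=-\mathbf d\theta$ is the canonical symplectic form of $T^*H$ ($\theta$ being the canonical one-form) and $B$ is pulled back along $(\alpha_g,p)\mapsto(g,p)$. Let $$\Lambda:T^*H\times P\to H\times\mathfrak h^*\times P,\qquad \Lambda(\alpha_g,p)=(g,\;T^*L_g(\alpha_g),\;g^{-1}\cdot p),$$ put $\Omega_{\rm body}=\Lambda_*\Omega$,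 and let $\mathcal S(g,\mu,x)=(g,\mu-\phi(e,x),x)$ on $H\times\mathfrak h^*\times P$. For a symplectic form $\omega$ let $\{F,K\}=X_K(F)$, where $\mathbf i_{X_K}\omega=\mathbf dK$; write $\{\cdot,\cdot\}_P$ for the bracket of $\omega_P$. For functions $f$, $k$ on $\mathfrak h^*$ let $\frac{\delta f}{\delta\mu}\in\mathfrak h$ be the functional derivative and $\{f,k\}_{\rm l.p}(\mu)=-\big\langle\mu,\big[\frac{\delta f}{\delta\mu},\frac{\delta k}{\delta\mu}\big]\big\rangle$. Let $\Sigma$ be the non-equivariance two-cocycle of $\phi$: for $\xi,\eta\in\mathfrak h$, $\Sigma(\xi,\eta)(h,p)$ is the derivative at $g=e$ in the direction $\xi$ of $g\mapsto-\langle\phi(gh,g\cdot p),\eta\rangle+\langle\phi(h,p),\mathrm{Ad}_{g^{-1}}\eta\rangle$. Then $\mathcal S_*\Omega_{\rm body}$ is a symplectic form on $H\times\mathfrak h^*\times P$, and it is invariant under the action $h\cdot(g,\mu,x)=(hg,\mu,x)$ of $H$. The bracket that it induces on the quotient $\mathfrak h^*\times P$, characterized by $\{f,k\}\circ\pi=\{f\circ\pi,k\circ\pi\}$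 with $\pi(g,\mu,x)=(\mu,x)$, is the natural bracket: for all smooth $f$, $k$ on $\mathfrak h^*\times P$ and all $(\mu,x)$, $$\{f,k\}_\Sigma(\mu,x)=\{f(\cdot,x),k(\cdot,x)\}_{\rm l.p}(\mu)+\{f(\mu,\cdot),k(\mu,\cdot)\}_P(x)+\Sigma\Big(\frac{\delta f}{\delta\mu},\frac{\delta k}{\delta\mu}\Big)(e,x),$$ with $\frac{\delta f}{\delta\mu}$, $\frac{\delta k}{\delta\mu}$ taken at $(\mu,x)$ for fixed $x$. -/

import Mathlib

open scoped Manifold ContDiff Bundle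

noncomputable section

namespace BodyReduction

/-! ### Differential forms on manifolds without boundary -/

section Forms

variable {E : Type*} [NormedAddCommGroup E] [NormedSpace ℝ E]
  {X : Type*} [TopologicalSpace X] (I : ModelWithCorners ℝ E X)
  {M : Type*} [TopologicalSpace M] [ChartedSpace X M]
  {F : Type*} [NormedAddCommGroup F] [NormedSpace ℝ F]
  {Y : Type*} [TopologicalSpace Y] (J : ModelWithCorners ℝ F Y)
  {N : Type*} [TopologicalSpace N] [ChartedSpace Y N]

/-- A (not necessarily smooth) differential `k`-form on `M`. -/
abbrev DiffForm (M : Type*) [TopologicalSpace M] [ChartedSpace X M] (k : ℕ) : Type _ :=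
  ∀ x : M, TangentSpace I x [⋀^Fin k]→L[ℝ] ℝ

variable {k : ℕ}

/-- The pull-back `f^* Ω`. -/
def pullback (f : M → N) (Ω : DiffForm J N k) : DiffForm I M k :=
  fun x => (Ω (f x)).compContinuousLinearMap (mfderiv I J f x)

/-- The push-forward `e_* Ω = (e⁻¹)^* Ω` along a bijection (used for diffeomorphisms). -/
def pushforward (e : M ≃ N) (Ω : DiffForm I M k) : DiffForm J N k :=
  pullback J I e.symm Ω

/-- The form `Ω` read in the chart around `x₀`. -/
def chartRep (Ω : DiffForm I M k) (x₀ : M) : E → E [⋀^Fin k]→L[ℝ] ℝ :=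
  pullback 𝓘(ℝ, E) I (extChartAt I x₀).symm Ω

/-- `Ω` is smooth: its expressions in all preferred charts are `C^∞`. -/
def IsSmoothForm (Ω : DiffForm I M k) : Prop :=
  ∀ x₀ : M, ContDiffOn ℝ ∞ (chartRep I Ω x₀) (extChartAt I x₀).target

/-- The exterior derivative, computed at `x` in the chart around `x`. -/
def extD (Ω : DiffForm I M k) : DiffForm I M (k + 1) := fun x =>
  (extDeriv (chartRep I Ω x) (extChartAt I x x)).compContinuousLinearMap
    (mfderiv I 𝓘(ℝ, E) (extChartAt I x) x)

/-- `Ω` is a symplectic form. -/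
structure IsSymplectic (Ω : DiffForm I M 2) : Prop where
  smooth : IsSmoothForm I Ω
  closed : ∀ x, extD I Ω x = 0
  nondegenerate : ∀ (x : M) (v : TangentSpace I x), (∀ w : TangentSpace I x, Ω x ![v, w] = 0) → v = 0

/-- The value at `x` of the Hamiltonian vector field `X_K`, given by `i_{X_K} Ω = dK`. It exists and
is unique when `Ω` is nondegenerate, see `hamVec_spec` and `hamVec_unique`. -/
def hamVec (Ω : DiffForm I M 2) (K : M → ℝ) (x : M) : TangentSpace I x :=
  Classical.epsilon fun v => ∀ w : TangentSpace I x, Ω x ![v, w] = mvfderiv I K x w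

/-- The bracket `{F, K} = X_K(F)` associated with a symplectic form `Ω`. -/
def poissonBracket (Ω : DiffForm I M 2) (F K : M → ℝ) (x : M) : ℝ :=
  mvfderiv I F x (hamVec I Ω K x)

variable {I}

lemma update_zero {V : Type*} (v w a : V) : Function.update ![v, w] 0 a = ![a, w] := by
  ext i; fin_cases i <;> rfl

lemma update_one {V : Type*} (v w a : V) : Function.update ![v, w] 1 a = ![v, a] := by
  ext i; fin_cases i <;> rfl

lemma hamVec_spec [FiniteDimensional ℝ E] {Ω : DiffForm I M 2} (hΩ : IsSymplectic I Ω)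
    (K : M → ℝ) (x : M) (w : TangentSpace I x) :
    Ω x ![hamVec I Ω K x, w] = mvfderiv I K x w := by
  have key : ∃ v : TangentSpace I x, ∀ w : TangentSpace I x,
      Ω x ![v, w] = mvfderiv I K x w := by
    have : FiniteDimensional ℝ (TangentSpace I x) := inferInstanceAs (FiniteDimensional ℝ E)
    let T : TangentSpace I x →ₗ[ℝ] Module.Dual ℝ (TangentSpace I x) :=
      LinearMap.mk₂ ℝ (fun v w => Ω x ![v, w])
        (fun v v' w => by
          have h := (Ω x).map_update_add ![v, w] 0 v v'
          rwa [update_zero, update_zero, update_zero] at h)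
        (fun c v w => by
          have h := (Ω x).map_update_smul ![v, w] 0 c v
          rwa [update_zero, update_zero] at h)
        (fun v w w' => by
          have h := (Ω x).map_update_add ![v, w] 1 w w'
          rwa [update_one, update_one, update_one] at h)
        (fun c v w => by
          have h := (Ω x).map_update_smul ![v, w] 1 c w
          rwa [update_one, update_one] at h)
    have hT : Function.Injective T := by
      rw [← LinearMap.ker_eq_bot, LinearMap.ker_eq_bot']
      intro v hv
      exact hΩ.nondegenerate x v fun w => LinearMap.congr_fun hv w
    have hs : Function.Surjective T :=
      (LinearMap.injective_iff_surjective_of_finrank_eq_finrank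
        (Subspace.dual_finrank_eq).symm).1 hT
    obtain ⟨v, hv⟩ := hs (mvfderiv I K x).toLinearMap
    exact ⟨v, fun w => LinearMap.congr_fun hv w⟩
  exact Classical.epsilon_spec key w

lemma hamVec_unique [FiniteDimensional ℝ E] {Ω : DiffForm I M 2} (hΩ : IsSymplectic I Ω)
    (K : M → ℝ) (x : M) (v : TangentSpace I x)
    (hv : ∀ w : TangentSpace I x, Ω x ![v, w] = mvfderiv I K x w) : v = hamVec I Ω K x := by
  rw [← sub_eq_zero]
  refine hΩ.nondegenerate x _ fun w => ?_
  have h := (Ω x).map_update_sub ![v, w] 0 v (hamVec I Ω K x)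
  rw [update_zero, update_zero, update_zero] at h
  rw [h, hv w, hamVec_spec hΩ K x w, sub_self]

end Forms

/-! ### The cotangent bundle and its canonical form -/

section Cotangent

variable {E : Type*} [NormedAddCommGroup E] [NormedSpace ℝ E]
  {X : Type*} [TopologicalSpace X] (I : ModelWithCorners ℝ E X)
  (M : Type*) [TopologicalSpace M] [ChartedSpace X M] [IsManifold I ∞ M]

/-- The cotangent bundle `T^*M`; its points are `⟨g, α⟩` with `α` in the dual of `T_g M`. -/
abbrev CotangentBundle : Type _ :=
  Bundle.TotalSpace (E →L[ℝ] ℝ) (fun g : M => TangentSpace I g →L[ℝ] ℝ)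

/-- The model with corners of `T^*M`. -/
abbrev cotangentModel : ModelWithCorners ℝ (E × (E →L[ℝ] ℝ)) (ModelProd X (E →L[ℝ] ℝ)) :=
  I.prod 𝓘(ℝ, E →L[ℝ] ℝ)

/-- The canonical one-form `θ`: `θ(α)(w) = α(Tπ(w))` with `π : T^*M → M` the projection. -/
def canonicalOneForm : DiffForm (cotangentModel I) (CotangentBundle I M) 1 := fun α =>
  ContinuousAlternatingMap.ofSubsingleton ℝ (TangentSpace (cotangentModel I) α) ℝ (0 : Fin 1)
    (α.snd.comp (mfderiv (cotangentModel I) I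
      (fun β : CotangentBundle I M => β.proj) α))

/-- The canonical symplectic form `ω_can = -dθ` (that is, `dq ∧ dp`). -/
def canonicalForm : DiffForm (cotangentModel I) (CotangentBundle I M) 2 :=
  fun α => -extD (cotangentModel I) (canonicalOneForm I M) α

end Cotangent

/-! ### A Lie group `H` coupled to a symplectic manifold `P`

The Lie algebra `𝔥 = GroupLieAlgebra I H` is the tangent space at the identity, whose underlying
vector space is the model space `E`, with the bracket of left-invariant vector fields. -/

section LieGroup

variable {E : Type*} [NormedAddCommGroup E] [NormedSpace ℝ E]
  {X : Type*} [TopologicalSpace X] (I : ModelWithCorners ℝ E X)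
  {H : Type*} [TopologicalSpace H] [ChartedSpace X H] [Group H]

/-- The dual `𝔥^*` of the Lie algebra of `H`, normed as the dual of the model space of `H`. -/
abbrev LieDual (_I : ModelWithCorners ℝ E X) (H : Type*) [TopologicalSpace H] [ChartedSpace X H]
    [Group H] : Type _ := E →L[ℝ] ℝ

/-- The tangent map `T_1 L_g : 𝔥 → T_g H` of left translation. -/
def leftTangent (g : H) : GroupLieAlgebra I H →L[ℝ] TangentSpace I g :=
  (mfderiv I I (fun h : H => g * h) (1 : H) : E →L[ℝ] E)

/-- The tangent map `T_g L_{g⁻¹} : T_g H → 𝔥` of left translation. -/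
def leftTangentInv (g : H) : TangentSpace I g →L[ℝ] GroupLieAlgebra I H :=
  (mfderiv I I (fun h : H => g⁻¹ * h) g : E →L[ℝ] E)

/-- The adjoint action `Ad_g` of `H` on `𝔥`. -/
def Ad (g : H) : GroupLieAlgebra I H →L[ℝ] GroupLieAlgebra I H :=
  (mfderiv I I (fun h : H => g * h * g⁻¹) (1 : H) : E →L[ℝ] E)

/-- The (left) coadjoint action `⟨Ad^*_g ν, η⟩ = ⟨ν, Ad_{g⁻¹} η⟩` of `H` on `𝔥^*`. -/
def coAd (g : H) (ν : LieDual I H) : LieDual I H :=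
  ContinuousLinearMap.comp (M₁ := E) (M₂ := E) ν (Ad I g⁻¹)

/-- The functional derivative `δf/δμ ∈ 𝔥` of a function on `𝔥^*` at `μ`: the element with
`⟨ρ, δf/δμ⟩ = Df(μ) · ρ` for all `ρ ∈ 𝔥^*`, see `funDeriv_spec`. -/
def funDeriv (f : LieDual I H → ℝ) (μ : LieDual I H) : GroupLieAlgebra I H :=
  Classical.epsilon (α := E) fun ξ => ∀ ρ : E →L[ℝ] ℝ, ρ ξ = fderiv ℝ f μ ρ

lemma funDeriv_spec [FiniteDimensional ℝ E] (f : LieDual I H → ℝ) (μ ρ : LieDual I H) :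
    ρ (funDeriv I f μ) = fderiv ℝ f μ ρ := by
  have key : ∃ ξ : E, ∀ ρ : E →L[ℝ] ℝ, ρ ξ = fderiv ℝ f μ ρ := by
    let c : Module.Dual ℝ E ≃ₗ[ℝ] (E →L[ℝ] ℝ) := LinearMap.toContinuousLinearMap
    obtain ⟨ξ, hξ⟩ := (Module.evalEquiv ℝ E).surjective ((fderiv ℝ f μ).toLinearMap ∘ₗ c.toLinearMap)
    refine ⟨ξ, fun ρ => ?_⟩
    have h := LinearMap.congr_fun hξ (c.symm ρ)
    simp only [Module.evalEquiv_apply, LinearMap.comp_apply, LinearEquiv.coe_coe,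
      LinearEquiv.apply_symm_apply, Module.Dual.eval_apply] at h
    exact h
  exact Classical.epsilon_spec key ρ

/-- The Lie-Poisson bracket `{f, k}(μ) = -⟨μ, [δf/δμ, δk/δμ]⟩` on `𝔥^*`, the one obtained from
`T^*H` by left translation. -/
def liePoissonBracket (f k : LieDual I H → ℝ) (μ : LieDual I H) : ℝ :=
  -μ (⁅funDeriv I f μ, funDeriv I k μ⁆ : GroupLieAlgebra I H)

end LieGroup

section Coupling

variable {E : Type*} [NormedAddCommGroup E] [NormedSpace ℝ E]
  {X : Type*} [TopologicalSpace X] (I : ModelWithCorners ℝ E X)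
  {H : Type*} [TopologicalSpace H] [ChartedSpace X H] [Group H]
  {F : Type*} [NormedAddCommGroup F] [NormedSpace ℝ F]
  {Y : Type*} [TopologicalSpace Y] (J : ModelWithCorners ℝ F Y)
  {P : Type*} [TopologicalSpace P] [ChartedSpace Y P] [MulAction H P]

/-- The diagonal action of `h` on `H × P`. -/
def diagAct (h : H) (z : H × P) : H × P := (h * z.1, h • z.2)

/-- The fundamental vector field `ξ_{H × P}` of the diagonal action on `H × P`: the derivative of
`h ↦ h · z` at the identity in the direction `ξ`. -/
def fundField (ξ : GroupLieAlgebra I H) (z : H × P) : TangentSpace (I.prod J) z :=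
  (mfderiv I (I.prod J) (fun h : H => diagAct h z) (1 : H) : E →L[ℝ] E × F) ξ

/-- `φ : H × P → 𝔥^*` is a (smooth) `ℬ𝔤`-potential of `B`: `i_{ξ_{H × P}} B = d⟨φ, ξ⟩`. -/
structure IsBgPotential (B : DiffForm (I.prod J) (H × P) 2) (φ : H × P → LieDual I H) : Prop where
  smooth : ContMDiff (I.prod J) 𝓘(ℝ, E →L[ℝ] ℝ) ∞ φ
  potential : ∀ (ξ : GroupLieAlgebra I H) (z : H × P) (w : TangentSpace (I.prod J) z),
    B z ![fundField I J ξ z, w] =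
      mvfderiv (I.prod J) (fun y : H × P => φ y ξ) z w

/-- The functions `Γ_{η,g}(h, p) = -⟨φ(gh, gp), η⟩ + ⟨Ad^*_g φ(h, p), η⟩`; the one-cocycle of `φ` is
`σ(g) · η = Γ_{η,g}`. -/
def oneCocycle (φ : H × P → LieDual I H) (g : H) (η : GroupLieAlgebra I H) (z : H × P) : ℝ :=
  -φ (diagAct g z) η + coAd I g (φ z) η

/-- The non-equivariance two-cocycle `Σ(ξ, η) = T_e σ_η(ξ)`, a function on `H × P`. -/
def twoCocycle (φ : H × P → LieDual I H) (ξ η : GroupLieAlgebra I H) (z : H × P) : ℝ :=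
  mvfderiv I (fun g : H => oneCocycle I φ g η z) (1 : H) ξ

/-- The natural bracket on `𝔥^* × P`:
`{f, k}_Σ = {f|𝔥^*, k|𝔥^*}_{l.p.} + {f|P, k|P}_P + Σ(δf/δμ, δk/δμ)`,
the function `Σ(ξ, η)` being evaluated at `(e, x)`. -/
def naturalBracket (ωP : DiffForm J P 2) (φ : H × P → LieDual I H)
    (f k : LieDual I H × P → ℝ) (y : LieDual I H × P) : ℝ :=
  liePoissonBracket I (H := H) (fun μ => f (μ, y.2)) (fun μ => k (μ, y.2)) y.1
    + poissonBracket J ωP (fun x => f (y.1, x)) (fun x => k (y.1, x)) y.2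
    + twoCocycle I φ (funDeriv I (fun μ => f (μ, y.2)) y.1) (funDeriv I (fun μ => k (μ, y.2)) y.1)
        ((1 : H), y.2)

/-- The shift map `S(g, μ, x) = (g, μ - φ(e, x), x)` of `H × 𝔥^* × P`. -/
def shiftMap (φ : H × P → LieDual I H) :
    (H × (LieDual I H × P)) ≃ (H × (LieDual I H × P)) where
  toFun z := (z.1, z.2.1 - φ (1, z.2.2), z.2.2)
  invFun z := (z.1, z.2.1 + φ (1, z.2.2), z.2.2)
  left_inv z := by simp
  right_inv z := by simp

/-- The model with corners of `H × 𝔥^* × P`. -/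
abbrev bodyModel : ModelWithCorners ℝ (E × ((E →L[ℝ] ℝ) × F)) (ModelProd X (ModelProd (E →L[ℝ] ℝ) Y)) :=
  I.prod (𝓘(ℝ, E →L[ℝ] ℝ).prod J)

/-- The action of `h` on `H × 𝔥^* × P`: left translation in the first factor. -/
def bodyAct (h : H) (z : H × (LieDual I H × P)) : H × (LieDual I H × P) := (h * z.1, z.2)

/-- `br` is the bracket on `(H × 𝔥^* × P)/H = 𝔥^* × P` induced by the symplectic form `Ω` on
`H × 𝔥^* × P`: `{f, k} ∘ π = {f ∘ π, k ∘ π}_Ω`, with `π(g, μ, x) = (μ, x)`. -/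
def IsInducedBracket (Ω : DiffForm (bodyModel I J) (H × (LieDual I H × P)) 2)
    (br : (LieDual I H × P → ℝ) → (LieDual I H × P → ℝ) → (LieDual I H × P → ℝ)) : Prop :=
  ∀ f k : LieDual I H × P → ℝ,
    ContMDiff (𝓘(ℝ, E →L[ℝ] ℝ).prod J) 𝓘(ℝ, ℝ) ∞ f →
    ContMDiff (𝓘(ℝ, E →L[ℝ] ℝ).prod J) 𝓘(ℝ, ℝ) ∞ k →
    br f k ∘ (Prod.snd : H × (LieDual I H × P) → LieDual I H × P) =
      poissonBracket (bodyModel I J) Ω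
        (f ∘ (Prod.snd : H × (LieDual I H × P) → LieDual I H × P))
        (k ∘ (Prod.snd : H × (LieDual I H × P) → LieDual I H × P))

variable [LieGroup I ∞ H]

/-- The magnetic form `Ω = ω_can - B` on `T^*H × P`, the two summands being pulled back along
`(α_g, p) ↦ α_g` and `(α_g, p) ↦ (g, p)`. -/
def magneticForm (B : DiffForm (I.prod J) (H × P) 2) :
    DiffForm ((cotangentModel I).prod J) (CotangentBundle I H × P) 2 := fun z =>
  pullback ((cotangentModel I).prod J) (cotangentModel I)
      (Prod.fst : CotangentBundle I H × P → CotangentBundle I H) (canonicalForm I H) z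
    - pullback ((cotangentModel I).prod J) (I.prod J)
      (fun y : CotangentBundle I H × P => (y.1.proj, y.2)) B z

variable {I} in
lemma leftTangent_comp_leftTangentInv (g : H) (v : TangentSpace I g) :
    leftTangent I g (leftTangentInv I g v) = v := by
  have h0 : (∞ : WithTop ℕ∞) ≠ 0 := by simp
  have h1 : (fun h : H => g * h) ∘ (fun h : H => g⁻¹ * h) = id := by
    ext h; simp
  have hc := mfderiv_comp (I := I) (I' := I) (I'' := I) (x := g)
    (g := fun h : H => g * h) (f := fun h : H => g⁻¹ * h)
    ((contMDiff_mul_left (I := I) (n := ∞)).contMDiffAt.mdifferentiableAt h0)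
    ((contMDiff_mul_left (I := I) (n := ∞)).contMDiffAt.mdifferentiableAt h0)
  rw [h1, mfderiv_id] at hc
  have h2 : g⁻¹ * g = 1 := inv_mul_cancel g
  rw [h2] at hc
  exact (DFunLike.congr_fun hc v).symm

variable {I} in
lemma leftTangentInv_comp_leftTangent (g : H) (v : GroupLieAlgebra I H) :
    leftTangentInv I g (leftTangent I g v) = v := by
  have h0 : (∞ : WithTop ℕ∞) ≠ 0 := by simp
  have h1 : (fun h : H => g⁻¹ * h) ∘ (fun h : H => g * h) = id := by
    ext h; simp
  have hc := mfderiv_comp (I := I) (I' := I) (I'' := I) (x := (1 : H))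
    (g := fun h : H => g⁻¹ * h) (f := fun h : H => g * h)
    ((contMDiff_mul_left (I := I) (n := ∞)).contMDiffAt.mdifferentiableAt h0)
    ((contMDiff_mul_left (I := I) (n := ∞)).contMDiffAt.mdifferentiableAt h0)
  rw [h1, mfderiv_id] at hc
  have h2 : g * 1 = g := mul_one g
  rw [h2] at hc
  exact (DFunLike.congr_fun hc v).symm

variable (H P) in
/-- Left trivialization `Λ(α_g, p) = (g, T^*L_g(α_g), g⁻¹ · p)` from `T^*H × P` to `H × 𝔥^* × P`,
with inverse `(g, μ, x) ↦ (μ ∘ T L_{g⁻¹}, g · x)`. -/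
def bodyMap : (CotangentBundle I H × P) ≃ (H × (LieDual I H × P)) where
  toFun z := (z.1.proj, ContinuousLinearMap.comp z.1.snd (leftTangent I z.1.proj), z.1.proj⁻¹ • z.2)
  invFun y := (⟨y.1, ContinuousLinearMap.comp (M₂ := E) y.2.1 (leftTangentInv I y.1)⟩,
    y.1 • y.2.2)
  left_inv z := by
    obtain ⟨⟨g, α⟩, p⟩ := z
    refine Prod.ext ?_ (smul_inv_smul g p)
    refine congrArg (Bundle.TotalSpace.mk g) ?_
    refine ContinuousLinearMap.ext fun v => ?_
    exact congrArg α (leftTangent_comp_leftTangentInv g v)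
  right_inv y := by
    obtain ⟨g, μ, x⟩ := y
    refine Prod.ext rfl (Prod.ext ?_ (inv_smul_smul g x))
    refine ContinuousLinearMap.ext fun v => ?_
    exact congrArg μ (leftTangentInv_comp_leftTangent g v)

/-- The form `Ω_body = Λ_* Ω` on `H × 𝔥^* × P`. -/
def bodyForm (B : DiffForm (I.prod J) (H × P) 2) :
    DiffForm (bodyModel I J) (H × (LieDual I H × P)) 2 :=
  pushforward ((cotangentModel I).prod J) (bodyModel I J) (bodyMap I H P) (magneticForm I J B)

/-- The shifted form `S_* Ω_body` on `H × 𝔥^* × P`. -/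
def shiftedForm (B : DiffForm (I.prod J) (H × P) 2) (φ : H × P → LieDual I H) :
    DiffForm (bodyModel I J) (H × (LieDual I H × P)) 2 :=
  pushforward (bodyModel I J) (bodyModel I J) (shiftMap I φ) (bodyForm I J B)

end Coupling

end BodyReduction

end

set_option linter.unusedSectionVars false

/-! The form becomes explicit once it is read over the identity of `H`. A push-forward is a
pull-back along the inverse, so `shiftedForm_eq` writes the shifted form as `-dΘ - s^*B`. Here `Θ =
⟨μ + φ(e, x), λ⟩` with `λ` the left Maurer-Cartan form, obtained from the tautological property of
the canonical one-form, and `s(g, μ, x) = (g, g · x)`. Closedness follows from `d² = 0` and `dB =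
0`. Invariance holds because `λ` is left-invariant and `s` intertwines left translation with the
diagonal action, which preserves `B`. It therefore suffices to know the form at `g = e`.

Two computations meet there. By the Maurer-Cartan equation, `dΘ` consists of the duality pairing,
derivatives of `φ` along `P`, and a term `-⟨ν + φ(e, x), [ξ, ξ']⟩` (`extD_bodyOneForm`). The
differential of `s` splits a vector into an orbit direction, on which the potential equation turns
`B` into `dφ`, and a `P`-direction, on which `B` is `-ω_P` (`pullback_spatialMap_apply`). The
derivatives of `φ` along `P` cancel, which is the purpose of the shift; the other terms in `φ` add
up to `-Σ` by `twoCocycle_apply`. On vectors `(ξ, ρ, u)` and `(ξ', ρ', u')` the result is `ρ'(ξ) -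
ρ(ξ') + ⟨ν, [ξ, ξ']⟩ - Σ(ξ, ξ')(e, x) + ω_P(u, u')` (`shiftedForm_one_apply`).

This expression is triangular with respect to the directions of `P`, of the dual and of the group,
so it inherits nondegeneracy from `ω_P`. The same three tests solve for the Hamiltonian vector of `k
∘ π`: its `P`-part is that of `ω_P`, its group part is `δk/δμ`, and its dual part paired with
`δf/δμ` produces the Lie-Poisson and cocycle terms.

The supporting facts are the naturality of `d` (`extD_pullback`) and the description of the bracket
and of the derivative of `Ad` by second derivatives of the multiplication in a single chart
(`bracket_eq_fderiv_leftFactor`, `hasMFDerivAt_adInv`). -/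

noncomputable section

namespace BodyReduction

open Set Filter Topology VectorField

/-! ### Smooth families of alternating forms on a vector space. -/

section AlternatingCalculus

variable {D : Type*} [NormedAddCommGroup D] [NormedSpace ℝ D]
  {E : Type*} [NormedAddCommGroup E] [NormedSpace ℝ E]
  {F : Type*} [NormedAddCommGroup F] [NormedSpace ℝ F] {k : ℕ}

/-- An alternating form is determined by its values on tuples of basis vectors. Evaluation on these
tuples is an injective linear map into a finite-dimensional space, and a continuous left inverse
recovers the family from finitely many scalar functions. -/
lemma contDiffAt_alternating_iff [FiniteDimensional ℝ E] {n : WithTop ℕ∞}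
    {β : D → E [⋀^Fin k]→L[ℝ] ℝ} {x : D} :
    ContDiffAt ℝ n β x ↔ ∀ v : Fin k → E, ContDiffAt ℝ n (fun y => β y v) x := by
  constructor
  · intro h v
    exact ((ContinuousMultilinearMap.apply ℝ (fun _ : Fin k => E) ℝ v).comp
      (ContinuousAlternatingMap.toContinuousMultilinearMapCLM ℝ)).contDiff.contDiffAt.comp x h
  · intro h
    let b := Module.finBasis ℝ E
    let ev : (E [⋀^Fin k]→L[ℝ] ℝ) →ₗ[ℝ] ((Fin k → Fin (Module.finrank ℝ E)) → ℝ) :=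
      { toFun := fun η s => η fun i => b (s i)
        map_add' := fun _ _ => rfl
        map_smul' := fun _ _ => rfl }
    have hev : LinearMap.ker ev = ⊥ := by
      rw [LinearMap.ker_eq_bot]
      intro η η' h
      apply ContinuousAlternatingMap.toAlternatingMap_injective
      refine Module.Basis.ext_alternating b fun s _ => ?_
      exact congrFun h s
    obtain ⟨g, hg⟩ := LinearMap.exists_leftInverse_of_injective ev hev
    have hβ : β = fun y => LinearMap.toContinuousLinearMap g (ev (β y)) := by
      funext y
      exact (LinearMap.congr_fun hg (β y)).symm
    rw [hβ]
    refine (LinearMap.toContinuousLinearMap g).contDiff.contDiffAt.comp x ?_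
    rw [contDiffAt_pi]
    exact fun s => h _

lemma contDiffAt_compContinuousLinearMap [FiniteDimensional ℝ E] {n : WithTop ℕ∞}
    {β : D → F [⋀^Fin k]→L[ℝ] ℝ} {A : D → E →L[ℝ] F} {x : D}
    (hβ : ContDiffAt ℝ n β x) (hA : ContDiffAt ℝ n A x) :
    ContDiffAt ℝ n (fun y => (β y).compContinuousLinearMap (A y)) x := by
  rw [contDiffAt_alternating_iff]
  intro v
  have h1 : ContDiffAt ℝ n (fun y =>
      ContinuousMultilinearMap.compContinuousLinearMapContinuousMultilinear ℝ
        (fun _ : Fin k => E) (fun _ : Fin k => F) ℝ (fun _ => A y)) x :=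
    (ContinuousMultilinearMap.contDiff _).contDiffAt.comp x (contDiffAt_pi.2 fun _ => hA)
  have h2 : ContDiffAt ℝ n (fun y => (β y).toContinuousMultilinearMap) x :=
    (ContinuousAlternatingMap.toContinuousMultilinearMapCLM (𝕜 := ℝ) (E := F) (ι := Fin k)
      (F := ℝ) ℝ).contDiff.contDiffAt.comp x hβ
  exact (ContinuousMultilinearMap.apply ℝ (fun _ : Fin k => E) ℝ v).contDiff.contDiffAt.comp x
    (h1.clm_apply h2)

lemma contDiffAt_extDeriv {β : E → E [⋀^Fin k]→L[ℝ] ℝ} {x : E} (hβ : ContDiffAt ℝ ∞ β x) :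
    ContDiffAt ℝ ∞ (extDeriv β) x := by
  have h : extDeriv β = fun y =>
      ContinuousAlternatingMap.alternatizeUncurryFinCLM ℝ E ℝ (fderiv ℝ β y) := by
    funext y
    rw [ContinuousAlternatingMap.alternatizeUncurryFinCLM_apply]
    rfl
  rw [h]
  exact (ContinuousAlternatingMap.alternatizeUncurryFinCLM (n := k) ℝ E ℝ).contDiff.contDiffAt.comp x
    (hβ.fderiv_right (m := ∞) le_rfl)

end AlternatingCalculus

/-! ### Pull-back and exterior derivative of forms on manifolds. -/

section Forms

variable {E : Type*} [NormedAddCommGroup E] [NormedSpace ℝ E]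
  {X : Type*} [TopologicalSpace X] {I : ModelWithCorners ℝ E X}
  {M : Type*} [TopologicalSpace M] [ChartedSpace X M]
  {F : Type*} [NormedAddCommGroup F] [NormedSpace ℝ F]
  {Y : Type*} [TopologicalSpace Y] {J : ModelWithCorners ℝ F Y}
  {N : Type*} [TopologicalSpace N] [ChartedSpace Y N]
  {G : Type*} [NormedAddCommGroup G] [NormedSpace ℝ G]
  {Z : Type*} [TopologicalSpace Z] {K : ModelWithCorners ℝ G Z}
  {Q : Type*} [TopologicalSpace Q] [ChartedSpace Z Q]
  {k : ℕ}

lemma pullback_comp {g : N → Q} {f : M → N} {Ω : DiffForm K Q k} {x : M}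
    (hg : MDifferentiableAt J K g (f x)) (hf : MDifferentiableAt I J f x) :
    pullback I K (g ∘ f) Ω x = pullback I J f (pullback J K g Ω) x := by
  unfold pullback
  rw [mfderiv_comp x hg hf]
  rfl

lemma pullback_congr {f g : M → N} {Ω : DiffForm J N k} {x : M} (h : f =ᶠ[𝓝 x] g) :
    pullback I J f Ω x = pullback I J g Ω x := by
  -- The two values live over different points; viewing both as forms on the model space `F` makes
  -- them comparable.
  have key : ∀ (p q : N), p = q →
      (show F [⋀^Fin k]→L[ℝ] ℝ from Ω p) = (show F [⋀^Fin k]→L[ℝ] ℝ from Ω q) := by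
    rintro p _ rfl
    rfl
  have hd : (mfderiv I J f x : E →L[ℝ] F) = mfderiv I J g x := h.mfderiv_eq
  exact congrArg₂ (fun (β : F [⋀^Fin k]→L[ℝ] ℝ) (A : E →L[ℝ] F) => β.compContinuousLinearMap A)
    (key _ _ h.eq_of_nhds) hd

lemma pullback_id {Ω : DiffForm I M k} {x : M} : pullback I I id Ω x = Ω x := by
  unfold pullback
  rw [mfderiv_id]
  rfl

variable (I) in
/-- Smoothness of a form at a point, in the chart around this point. -/
def SmoothFormAt (Ω : DiffForm I M k) (x : M) : Prop :=
  ContDiffAt ℝ ∞ (chartRep I Ω x) (extChartAt I x x)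

lemma pullback_extChartAt_symm_modelSpace (Ω : DiffForm 𝓘(ℝ, E) E k) (x : E) :
    chartRep 𝓘(ℝ, E) Ω x = Ω := by
  funext a
  exact pullback_id

lemma smoothFormAt_modelSpace {Ω : DiffForm 𝓘(ℝ, E) E k} {x : E} :
    SmoothFormAt 𝓘(ℝ, E) Ω x ↔ ContDiffAt ℝ ∞ (show E → E [⋀^Fin k]→L[ℝ] ℝ from Ω) x := by
  unfold SmoothFormAt
  rw [pullback_extChartAt_symm_modelSpace]
  rfl

lemma extD_modelSpace (Ω : DiffForm 𝓘(ℝ, E) E k) (x : E) :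
    extD 𝓘(ℝ, E) Ω x = extDeriv (show E → E [⋀^Fin k]→L[ℝ] ℝ from Ω) x := by
  unfold extD
  rw [pullback_extChartAt_symm_modelSpace, mfderiv_extChartAt_self]
  rfl

section Charts

variable [IsManifold I ∞ M] [IsManifold J ∞ N]

lemma contMDiffAt_extChartAt_symm [I.Boundaryless] {x₀ : M} {a : E}
    (ha : a ∈ (extChartAt I x₀).target) :
    ContMDiffAt 𝓘(ℝ, E) I ∞ (extChartAt I x₀).symm a :=
  (contMDiffOn_extChartAt_symm x₀).contMDiffAt (extChartAt_target_mem_nhds' ha)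

lemma infty_ne_zero : (∞ : WithTop ℕ∞) ≠ 0 := by simp

lemma eventually_mdifferentiableAt {f : M → N} {x : M} (hf : ContMDiffAt I J ∞ f x) :
    ∀ᶠ y in 𝓝 x, MDifferentiableAt I J f y := by
  have h1 : ContMDiffAt I J 1 f x := hf.of_le (by exact_mod_cast le_top)
  filter_upwards [(contMDiffAt_iff_contMDiffAt_nhds (by simp)).1 h1] with y hy
  exact hy.mdifferentiableAt one_ne_zero

variable (I) in
omit [IsManifold J ∞ N] in
lemma extD_eq (Ω : DiffForm I M k) (x : M) :
    extD I Ω x = extDeriv (chartRep I Ω x) (extChartAt I x x) := by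
  unfold extD
  rw [mfderiv_extChartAt_self]
  rfl

variable [I.Boundaryless] [J.Boundaryless]

omit [IsManifold I ∞ M] [IsManifold J ∞ N] [J.Boundaryless] in
lemma contDiffAt_writtenInExtChartAt {f : M → N} {x : M} (hf : ContMDiffAt I J ∞ f x) :
    ContDiffAt ℝ ∞ (writtenInExtChartAt I J x f) (extChartAt I x x) := by
  have h := (contMDiffAt_iff.1 hf).2
  rw [I.range_eq_univ] at h
  exact contDiffWithinAt_univ.1 h

/-- Near the base point, `f` after the inverse chart equals the inverse target chart after the
coordinate expression of `f`; the chain rule applied to both factorizations gives the formula. It is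
only an equality of germs, since `f` may leave the chart domain around `f x`. -/
lemma chartRep_pullback_eventuallyEq {f : M → N} {x : M} (hf : ContMDiffAt I J ∞ f x)
    (Ω : DiffForm J N k) :
    chartRep I (pullback I J f Ω) x =ᶠ[𝓝 (extChartAt I x x)] fun a =>
      (chartRep J Ω (f x) (writtenInExtChartAt I J x f a)).compContinuousLinearMap
        (fderiv ℝ (writtenInExtChartAt I J x f) a) := by
  have hs : ContinuousAt (extChartAt I x).symm (extChartAt I x x) := continuousAt_extChartAt_symm x
  have hx : (extChartAt I x).symm (extChartAt I x x) = x := extChartAt_to_inv x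
  have hd : ∀ᶠ a in 𝓝 (extChartAt I x x), MDifferentiableAt I J f ((extChartAt I x).symm a) := by
    apply hs.eventually
    rw [hx]
    exact eventually_mdifferentiableAt hf
  have hsrc : ∀ᶠ a in 𝓝 (extChartAt I x x),
      f ((extChartAt I x).symm a) ∈ (extChartAt J (f x)).source := by
    have := hf.continuousAt.eventually (extChartAt_source_mem_nhds (I := J) (f x))
    rw [← hx] at this
    simpa using! hs.eventually this
  filter_upwards [hd, hsrc, hsrc.eventually_nhds, extChartAt_target_mem_nhds x] with a h1 h2 h3 h4
  have hφ : MDifferentiableAt 𝓘(ℝ, E) I (extChartAt I x).symm a :=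
    (contMDiffAt_extChartAt_symm h4).mdifferentiableAt infty_ne_zero
  have hψ : MDifferentiableAt J 𝓘(ℝ, F) (extChartAt J (f x)) (f ((extChartAt I x).symm a)) :=
    mdifferentiableAt_extChartAt (by rwa [← extChartAt_source (I := J)])
  have hψ' : MDifferentiableAt 𝓘(ℝ, F) J (extChartAt J (f x)).symm
      (extChartAt J (f x) (f ((extChartAt I x).symm a))) :=
    (contMDiffAt_extChartAt_symm ((extChartAt J (f x)).map_source h2)).mdifferentiableAt
      infty_ne_zero
  have hw : MDifferentiableAt 𝓘(ℝ, E) 𝓘(ℝ, F) (writtenInExtChartAt I J x f) a :=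
    MDifferentiableAt.comp (I' := J) a hψ (MDifferentiableAt.comp (I' := I) a h1 hφ)
  have e1 : chartRep I (pullback I J f Ω) x a
      = pullback 𝓘(ℝ, E) J (f ∘ (extChartAt I x).symm) Ω a := (pullback_comp h1 hφ).symm
  have e2 : pullback 𝓘(ℝ, E) J (f ∘ (extChartAt I x).symm) Ω a
      = pullback 𝓘(ℝ, E) J ((extChartAt J (f x)).symm ∘ writtenInExtChartAt I J x f) Ω a := by
    apply pullback_congr
    filter_upwards [h3] with b hb
    exact ((extChartAt J (f x)).left_inv hb).symm
  have e3 := pullback_comp (Ω := Ω) (I := 𝓘(ℝ, E)) (J := 𝓘(ℝ, F)) (K := J)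
    (g := (extChartAt J (f x)).symm) (f := writtenInExtChartAt I J x f) (x := a) hψ' hw
  refine (e1.trans (e2.trans e3)).trans ?_
  unfold pullback
  rw [mfderiv_eq_fderiv]
  rfl

lemma SmoothFormAt.pullback [FiniteDimensional ℝ E] {f : M → N} {x : M}
    (hf : ContMDiffAt I J ∞ f x) {Ω : DiffForm J N k} (hΩ : SmoothFormAt J Ω (f x)) :
    SmoothFormAt I (pullback I J f Ω) x := by
  have hw := contDiffAt_writtenInExtChartAt hf
  refine ContDiffAt.congr_of_eventuallyEq ?_ (chartRep_pullback_eventuallyEq hf Ω)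
  refine contDiffAt_compContinuousLinearMap (ContDiffAt.comp _ ?_ hw)
    (hw.fderiv_right (m := ∞) le_rfl)
  simpa [writtenInExtChartAt, SmoothFormAt] using! hΩ

lemma minSmoothness_two_le : minSmoothness ℝ 2 ≤ (∞ : WithTop ℕ∞) := by
  rw [minSmoothness_of_isRCLikeNormedField]
  exact WithTop.coe_le_coe.2 le_top

/-- Naturality in normed spaces applies to the coordinate expression of `f`, because the exterior
derivative depends only on the germ. No chart derivatives remain: a preferred chart has identity
derivative at its own base point. -/
theorem extD_pullback {f : M → N} {x : M} (hf : ContMDiffAt I J ∞ f x) {Ω : DiffForm J N k}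
    (hΩ : SmoothFormAt J Ω (f x)) :
    extD I (pullback I J f Ω) x = pullback I J f (extD J Ω) x := by
  have hw := contDiffAt_writtenInExtChartAt hf
  have hx : writtenInExtChartAt I J x f (extChartAt I x x) = extChartAt J (f x) (f x) := by
    simp [writtenInExtChartAt]
  have h1 : extDeriv (chartRep I (pullback I J f Ω) x) (extChartAt I x x)
      = (extDeriv (chartRep J Ω (f x)) (extChartAt J (f x) (f x))).compContinuousLinearMap
        (fderiv ℝ (writtenInExtChartAt I J x f) (extChartAt I x x)) := by
    rw [(chartRep_pullback_eventuallyEq hf Ω).extDeriv_eq, extDeriv_pullback _ hw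
      minSmoothness_two_le, hx]
    rw [hx]
    exact ContDiffAt.differentiableAt hΩ infty_ne_zero
  have hfd := hf.mdifferentiableAt infty_ne_zero
  have h2 : (mfderiv I J f x : E →L[ℝ] F)
      = fderiv ℝ (writtenInExtChartAt I J x f) (extChartAt I x x) := by
    have h3 := hfd.mfderiv
    rw [I.range_eq_univ] at h3
    exact h3.trans (congrFun fderivWithin_univ _)
  rw [extD_eq]
  refine h1.trans ?_
  unfold BodyReduction.pullback
  rw [extD_eq, ← h2]
  rfl

/-- Reading a form in a chart is itself a pull-back, along the inverse chart. Hence smoothness at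
each point in the chart centred there passes to every other preferred chart. -/
lemma isSmoothForm_iff [FiniteDimensional ℝ E] {Ω : DiffForm I M k} :
    IsSmoothForm I Ω ↔ ∀ x, SmoothFormAt I Ω x := by
  constructor
  · intro h x
    exact (h x).contDiffAt (extChartAt_target_mem_nhds x)
  · intro h x₀ a ha
    have := (h ((extChartAt I x₀).symm a)).pullback (contMDiffAt_extChartAt_symm ha)
    exact (smoothFormAt_modelSpace.1 this).contDiffWithinAt

/-- The definition of `extD` changes chart from point to point. Naturality along one inverse chart
shows that in a fixed chart it is the ordinary exterior derivative, from which smoothness of `dΩ`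
and `d² = 0` follow. -/
lemma chartRep_extD {Ω : DiffForm I M k} (hΩ : ∀ x, SmoothFormAt I Ω x) {x₀ : M} {a : E}
    (ha : a ∈ (extChartAt I x₀).target) :
    chartRep I (extD I Ω) x₀ a = extDeriv (chartRep I Ω x₀) a := by
  have h := extD_pullback (contMDiffAt_extChartAt_symm ha) (hΩ _)
  rw [extD_modelSpace] at h
  exact h.symm

lemma smoothFormAt_extD {Ω : DiffForm I M k} (hΩ : ∀ x, SmoothFormAt I Ω x) (x : M) :
    SmoothFormAt I (extD I Ω) x := by
  refine ContDiffAt.congr_of_eventuallyEq (contDiffAt_extDeriv (hΩ x)) ?_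
  filter_upwards [extChartAt_target_mem_nhds x] with a ha
  exact chartRep_extD hΩ ha

lemma extD_extD {Ω : DiffForm I M k} (hΩ : ∀ x, SmoothFormAt I Ω x) (x : M) :
    extD I (extD I Ω) x = 0 := by
  have h : chartRep I (extD I Ω) x =ᶠ[𝓝 (extChartAt I x x)] extDeriv (chartRep I Ω x) := by
    filter_upwards [extChartAt_target_mem_nhds x] with a ha
    exact chartRep_extD hΩ ha
  have h0 : extDeriv (chartRep I (extD I Ω) x) (extChartAt I x x) = 0 := by
    rw [h.extDeriv_eq]
    exact extDeriv_extDeriv_apply (hΩ x) minSmoothness_two_le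
  unfold extD at h0 ⊢
  rw [h0]
  rfl

end Charts

lemma SmoothFormAt.sub {Ω Ω' : DiffForm I M k} {x : M} (h : SmoothFormAt I Ω x)
    (h' : SmoothFormAt I Ω' x) : SmoothFormAt I (fun y => Ω y - Ω' y) x :=
  ContDiffAt.sub h h'

lemma SmoothFormAt.neg {Ω : DiffForm I M k} {x : M} (h : SmoothFormAt I Ω x) :
    SmoothFormAt I (fun y => -Ω y) x :=
  ContDiffAt.neg h

lemma extD_neg {Ω : DiffForm I M k} {x : M} :
    extD I (fun y => -Ω y) x = -extD I Ω x := by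
  have h : extDeriv (chartRep I (fun y => -Ω y) x) (extChartAt I x x)
      = -extDeriv (chartRep I Ω x) (extChartAt I x x) := by
    have := extDeriv_fun_smul (-1 : ℝ) (chartRep I Ω x) (x := extChartAt I x x)
    simp only [neg_smul, one_smul] at this
    exact this
  unfold extD
  rw [h]
  rfl

lemma extD_sub {Ω Ω' : DiffForm I M k} {x : M} (hΩ : SmoothFormAt I Ω x)
    (hΩ' : SmoothFormAt I Ω' x) :
    extD I (fun y => Ω y - Ω' y) x = extD I Ω x - extD I Ω' x := by
  have h : extDeriv (chartRep I (fun y => Ω y - Ω' y) x) (extChartAt I x x)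
      = extDeriv (chartRep I Ω x) (extChartAt I x x)
        - extDeriv (chartRep I Ω' x) (extChartAt I x x) := by
    have e := extDeriv_fun_smul (-1 : ℝ) (chartRep I Ω' x) (x := extChartAt I x x)
    have a := extDeriv_fun_add (ContDiffAt.differentiableAt hΩ infty_ne_zero)
      (DifferentiableAt.const_smul (ContDiffAt.differentiableAt hΩ' infty_ne_zero) (-1 : ℝ))
    simp only [Pi.smul_apply] at a
    rw [e] at a
    simp only [neg_smul, one_smul, ← sub_eq_add_neg] at a
    exact a
  unfold extD
  rw [h]
  rfl

end Forms

/-! ### Derivatives of charts and of their inverses. -/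

section ChartDerivatives

variable {E : Type*} [NormedAddCommGroup E] [NormedSpace ℝ E]
  {X : Type*} [TopologicalSpace X] {I : ModelWithCorners ℝ E X} [I.Boundaryless]
  {M : Type*} [TopologicalSpace M] [ChartedSpace X M] [IsManifold I ∞ M]

lemma mfderiv_extChartAt_symm_apply_mfderiv {x₀ p : M} (hp : p ∈ (extChartAt I x₀).source)
    (v : TangentSpace I p) :
    (mfderiv 𝓘(ℝ, E) I (extChartAt I x₀).symm (extChartAt I x₀ p) : E →L[ℝ] E)
      ((mfderiv I 𝓘(ℝ, E) (extChartAt I x₀) p : E →L[ℝ] E) v) = v := by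
  have h := mfderivWithin_extChartAt_symm_comp_mfderiv_extChartAt' hp
  rw [I.range_eq_univ, mfderivWithin_univ] at h
  exact DFunLike.congr_fun h v

lemma mfderiv_extChartAt_apply_mfderiv_symm {x₀ : M} {a : E}
    (ha : a ∈ (extChartAt I x₀).target) (v : E) :
    (mfderiv I 𝓘(ℝ, E) (extChartAt I x₀) ((extChartAt I x₀).symm a) : E →L[ℝ] E)
      ((mfderiv 𝓘(ℝ, E) I (extChartAt I x₀).symm a : E →L[ℝ] E) v) = v := by
  have h := mfderiv_extChartAt_comp_mfderivWithin_extChartAt_symm ha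
  rw [I.range_eq_univ, mfderivWithin_univ] at h
  exact DFunLike.congr_fun h v

lemma mfderiv_extChartAt_symm_self (x : M) :
    (mfderiv 𝓘(ℝ, E) I (extChartAt I x).symm (extChartAt I x x) : E →L[ℝ] E)
      = ContinuousLinearMap.id ℝ E := by
  have h := mfderivWithin_range_extChartAt_symm (I := I) (x := x)
  rw [I.range_eq_univ, mfderivWithin_univ] at h
  exact h

end ChartDerivatives

/-! ### Multiplication, Maurer-Cartan form, bracket and `Ad` in a chart at the identity. -/

section LieGroupChart

variable {E : Type*} [NormedAddCommGroup E] [NormedSpace ℝ E]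
  {X : Type*} [TopologicalSpace X] (I : ModelWithCorners ℝ E X)
  (H : Type*) [TopologicalSpace H] [ChartedSpace X H] [Group H]

/-- The coordinates of the identity. -/
def chartOne : E := extChartAt I (1 : H) (1 : H)

/-- The multiplication read in the chart around the identity. -/
def mulChart (a : E × E) : E :=
  extChartAt I (1 : H) ((extChartAt I (1 : H)).symm a.1 * (extChartAt I (1 : H)).symm a.2)

/-- The tangent maps at `1` of left translations, in the chart around the identity. -/
def leftFactor (a : E) : E →L[ℝ] E := fderiv ℝ (fun b => mulChart I H (a, b)) (chartOne I H)

/-- The tangent maps at `1` of right translations, in the chart around the identity. -/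
def rightFactor (a : E) : E →L[ℝ] E := fderiv ℝ (fun b => mulChart I H (b, a)) (chartOne I H)

/-- The left Maurer-Cartan form in the chart around the identity. -/
def mcChart (a : E) : E →L[ℝ] E :=
  (leftTangentInv I ((extChartAt I (1 : H)).symm a) : E →L[ℝ] E).comp
    (mfderiv 𝓘(ℝ, E) I (extChartAt I (1 : H)).symm a : E →L[ℝ] E)

variable {H} [LieGroup I ∞ H]

variable {I} in
lemma mdifferentiableAt_mul_left (g h : H) : MDifferentiableAt I I (fun x : H => g * x) h :=
  (contMDiff_mul_left (I := I) (n := ∞)).contMDiffAt.mdifferentiableAt infty_ne_zero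

variable {I} in
lemma mdifferentiableAt_mul_right (g h : H) : MDifferentiableAt I I (fun x : H => x * g) h :=
  (contMDiff_mul_right (I := I) (n := ∞)).contMDiffAt.mdifferentiableAt infty_ne_zero

lemma leftTangentInv_one :
    (leftTangentInv I (1 : H) : E →L[ℝ] E) = ContinuousLinearMap.id ℝ E := by
  have h : (fun h : H => (1 : H)⁻¹ * h) = id := by ext; simp
  unfold leftTangentInv
  rw [h]
  exact mfderiv_id

variable [I.Boundaryless]

lemma contDiffAt_mulChart : ContDiffAt ℝ ∞ (mulChart I H) (chartOne I H, chartOne I H) := by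
  have := LieGroup.toContMDiffMul (I := I) (n := ∞) (G := H)
  have hs : ContMDiffAt 𝓘(ℝ, E) I ∞ (extChartAt I (1 : H)).symm (chartOne I H) :=
    contMDiffAt_extChartAt_symm (mem_extChartAt_target (1 : H))
  have h1 : ContMDiffAt 𝓘(ℝ, E × E) I ∞ (fun a : E × E => (extChartAt I (1 : H)).symm a.1)
      (chartOne I H, chartOne I H) :=
    ContMDiffAt.comp (chartOne I H, chartOne I H) (I' := 𝓘(ℝ, E)) hs
      contDiff_fst.contMDiff.contMDiffAt
  have h2 : ContMDiffAt 𝓘(ℝ, E × E) I ∞ (fun a : E × E => (extChartAt I (1 : H)).symm a.2)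
      (chartOne I H, chartOne I H) :=
    ContMDiffAt.comp (chartOne I H, chartOne I H) (I' := 𝓘(ℝ, E)) hs
      contDiff_snd.contMDiff.contMDiffAt
  have h3 := h1.mul h2
  have hone : (extChartAt I (1 : H)).symm (chartOne I H) * (extChartAt I (1 : H)).symm (chartOne I H)
      = (1 : H) := by
    rw [chartOne, extChartAt_to_inv, mul_one]
  have h4 : ContMDiffAt I 𝓘(ℝ, E) ∞ (extChartAt I (1 : H))
      ((extChartAt I (1 : H)).symm (chartOne I H) * (extChartAt I (1 : H)).symm (chartOne I H)) := by
    rw [hone]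
    exact contMDiffAt_extChartAt
  exact (ContMDiffAt.comp (chartOne I H, chartOne I H) h4 h3).contDiffAt

lemma eventually_leftFactor_eq_fderiv : leftFactor I H =ᶠ[𝓝 (chartOne I H)] fun a =>
    (fderiv ℝ (mulChart I H) (a, chartOne I H)).comp (ContinuousLinearMap.inr ℝ E E) := by
  have h1 : ∀ᶠ z in 𝓝 (chartOne I H, chartOne I H), DifferentiableAt ℝ (mulChart I H) z := by
    filter_upwards [((contDiffAt_mulChart I (H := H)).of_le
      (m := 1) (by exact_mod_cast le_top)).eventually (by simp)] with z hz
    exact hz.differentiableAt one_ne_zero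
  have h2 : ContinuousAt (fun a : E => (a, chartOne I H)) (chartOne I H) := by fun_prop
  filter_upwards [h2.eventually h1] with a ha
  have := ha.hasFDerivAt.comp (f := fun b : E => (a, b)) (chartOne I H)
    (hasFDerivAt_prodMk_right a (chartOne I H))
  exact this.fderiv

lemma eventually_rightFactor_eq_fderiv : rightFactor I H =ᶠ[𝓝 (chartOne I H)] fun a =>
    (fderiv ℝ (mulChart I H) (chartOne I H, a)).comp (ContinuousLinearMap.inl ℝ E E) := by
  have h1 : ∀ᶠ z in 𝓝 (chartOne I H, chartOne I H), DifferentiableAt ℝ (mulChart I H) z := by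
    filter_upwards [((contDiffAt_mulChart I (H := H)).of_le
      (m := 1) (by exact_mod_cast le_top)).eventually (by simp)] with z hz
    exact hz.differentiableAt one_ne_zero
  have h2 : ContinuousAt (fun a : E => (chartOne I H, a)) (chartOne I H) := by fun_prop
  filter_upwards [h2.eventually h1] with a ha
  have := ha.hasFDerivAt.comp (f := fun b : E => (b, a)) (chartOne I H)
    (hasFDerivAt_prodMk_left (chartOne I H) a)
  exact this.fderiv

lemma hasFDerivAt_fderiv_mulChart : HasFDerivAt (fderiv ℝ (mulChart I H))
    (fderiv ℝ (fderiv ℝ (mulChart I H)) (chartOne I H, chartOne I H))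
    (chartOne I H, chartOne I H) :=
  (((contDiffAt_mulChart I (H := H)).fderiv_right (m := ∞) le_rfl).differentiableAt
    infty_ne_zero).hasFDerivAt

lemma contDiffAt_leftFactor : ContDiffAt ℝ ∞ (leftFactor I H) (chartOne I H) := by
  refine ContDiffAt.congr_of_eventuallyEq ?_ (eventually_leftFactor_eq_fderiv I)
  have h := (contDiffAt_mulChart I (H := H)).fderiv_right (m := ∞) le_rfl
  have h2 : ContDiffAt ℝ ∞ (fun a : E => (a, chartOne I H)) (chartOne I H) :=
    contDiffAt_id.prodMk contDiffAt_const
  exact (ContDiffAt.comp (f := fun a : E => (a, chartOne I H)) (chartOne I H) h h2).clm_comp contDiffAt_const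

lemma contDiffAt_rightFactor : ContDiffAt ℝ ∞ (rightFactor I H) (chartOne I H) := by
  refine ContDiffAt.congr_of_eventuallyEq ?_ (eventually_rightFactor_eq_fderiv I)
  have h := (contDiffAt_mulChart I (H := H)).fderiv_right (m := ∞) le_rfl
  have h2 : ContDiffAt ℝ ∞ (fun a : E => (chartOne I H, a)) (chartOne I H) :=
    contDiffAt_const.prodMk contDiffAt_id
  exact (ContDiffAt.comp (f := fun a : E => (chartOne I H, a)) (chartOne I H) h h2).clm_comp contDiffAt_const

/-- `leftFactor` is the partial derivative of the multiplication in its second argument, so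
differentiating it in the first gives the mixed second derivative. -/
lemma fderiv_leftFactor_apply (ξ η : E) : fderiv ℝ (leftFactor I H) (chartOne I H) ξ η
    = fderiv ℝ (fderiv ℝ (mulChart I H)) (chartOne I H, chartOne I H) (ξ, 0) (0, η) := by
  have h := ((hasFDerivAt_fderiv_mulChart I (H := H)).comp (f := fun a : E => (a, chartOne I H))
    (chartOne I H) (hasFDerivAt_prodMk_left (chartOne I H) (chartOne I H))).clm_comp
    (hasFDerivAt_const (ContinuousLinearMap.inr ℝ E E) (chartOne I H))
  have h' := h.congr_of_eventuallyEq (eventually_leftFactor_eq_fderiv I)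
  rw [h'.fderiv]
  simp

/-- Symmetry of the second derivative of the multiplication: left and right translations differ to
first order only by exchanging the two arguments. -/
lemma fderiv_rightFactor_apply (ξ η : E) : fderiv ℝ (rightFactor I H) (chartOne I H) ξ η
    = fderiv ℝ (leftFactor I H) (chartOne I H) η ξ := by
  have h := ((hasFDerivAt_fderiv_mulChart I (H := H)).comp (f := fun a : E => (chartOne I H, a))
    (chartOne I H) (hasFDerivAt_prodMk_right (chartOne I H) (chartOne I H))).clm_comp
    (hasFDerivAt_const (ContinuousLinearMap.inl ℝ E E) (chartOne I H))
  have h' := h.congr_of_eventuallyEq (eventually_rightFactor_eq_fderiv I)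
  rw [h'.fderiv, fderiv_leftFactor_apply]
  have hs := (contDiffAt_mulChart I (H := H)).isSymmSndFDerivAt minSmoothness_two_le
  simpa using! hs (0, ξ) (η, 0)

lemma leftFactor_eq {a : E} (ha : a ∈ (extChartAt I (1 : H)).target) :
    leftFactor I H a
      = (mfderiv I 𝓘(ℝ, E) (extChartAt I (1 : H)) ((extChartAt I (1 : H)).symm a) :
          E →L[ℝ] E).comp (leftTangent I ((extChartAt I (1 : H)).symm a)) := by
  set g : H := (extChartAt I (1 : H)).symm a with hg
  have hs : HasMFDerivAt 𝓘(ℝ, E) I (extChartAt I (1 : H)).symm (chartOne I H)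
      (ContinuousLinearMap.id ℝ E) := by
    have := ((contMDiffAt_extChartAt_symm (I := I)
      (mem_extChartAt_target (1 : H))).mdifferentiableAt infty_ne_zero).hasMFDerivAt
    have e := mfderiv_extChartAt_symm_self (I := I) (1 : H)
    exact e ▸ this
  have hone : (extChartAt I (1 : H)).symm (chartOne I H) = 1 := extChartAt_to_inv (1 : H)
  have hl : HasMFDerivAt I I (fun h : H => g * h) ((extChartAt I (1 : H)).symm (chartOne I H))
      (leftTangent I g : E →L[ℝ] E) := by
    rw [hone]
    exact (mdifferentiableAt_mul_left g 1).hasMFDerivAt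
  have hgs : g ∈ (extChartAt I (1 : H)).source := (extChartAt I (1 : H)).map_target ha
  have hc : HasMFDerivAt I 𝓘(ℝ, E) (extChartAt I (1 : H))
      (g * (extChartAt I (1 : H)).symm (chartOne I H))
      (mfderiv I 𝓘(ℝ, E) (extChartAt I (1 : H)) g : E →L[ℝ] E) := by
    rw [hone, mul_one]
    exact (mdifferentiableAt_extChartAt (by rwa [← extChartAt_source (I := I)])).hasMFDerivAt
  let A : E →L[ℝ] E := mfderiv I 𝓘(ℝ, E) (extChartAt I (1 : H)) g
  let L : E →L[ℝ] E := leftTangent I g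
  have h : HasMFDerivAt 𝓘(ℝ, E) 𝓘(ℝ, E) (fun b => mulChart I H (a, b)) (chartOne I H) (A.comp L) :=
    HasMFDerivAt.comp (chartOne I H) hc (HasMFDerivAt.comp (chartOne I H) hl hs)
  have h' : HasFDerivAt (fun b => mulChart I H (a, b)) (A.comp L) (chartOne I H) := h.hasFDerivAt
  exact h'.fderiv

lemma rightFactor_eq {a : E} (ha : a ∈ (extChartAt I (1 : H)).target) :
    rightFactor I H a
      = (mfderiv I 𝓘(ℝ, E) (extChartAt I (1 : H)) ((extChartAt I (1 : H)).symm a) :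
          E →L[ℝ] E).comp
        (mfderiv I I (fun h : H => h * (extChartAt I (1 : H)).symm a) 1 : E →L[ℝ] E) := by
  set g : H := (extChartAt I (1 : H)).symm a with hg
  have hs : HasMFDerivAt 𝓘(ℝ, E) I (extChartAt I (1 : H)).symm (chartOne I H)
      (ContinuousLinearMap.id ℝ E) := by
    have := ((contMDiffAt_extChartAt_symm (I := I)
      (mem_extChartAt_target (1 : H))).mdifferentiableAt infty_ne_zero).hasMFDerivAt
    have e := mfderiv_extChartAt_symm_self (I := I) (1 : H)
    exact e ▸ this
  have hone : (extChartAt I (1 : H)).symm (chartOne I H) = 1 := extChartAt_to_inv (1 : H)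
  have hl : HasMFDerivAt I I (fun h : H => h * g) ((extChartAt I (1 : H)).symm (chartOne I H))
      (mfderiv I I (fun h : H => h * g) 1 : E →L[ℝ] E) := by
    rw [hone]
    exact (mdifferentiableAt_mul_right g 1).hasMFDerivAt
  have hgs : g ∈ (extChartAt I (1 : H)).source := (extChartAt I (1 : H)).map_target ha
  have hc : HasMFDerivAt I 𝓘(ℝ, E) (extChartAt I (1 : H))
      ((extChartAt I (1 : H)).symm (chartOne I H) * g)
      (mfderiv I 𝓘(ℝ, E) (extChartAt I (1 : H)) g : E →L[ℝ] E) := by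
    rw [hone, one_mul]
    exact (mdifferentiableAt_extChartAt (by rwa [← extChartAt_source (I := I)])).hasMFDerivAt
  let A : E →L[ℝ] E := mfderiv I 𝓘(ℝ, E) (extChartAt I (1 : H)) g
  let L : E →L[ℝ] E := mfderiv I I (fun h : H => h * g) 1
  have h : HasMFDerivAt 𝓘(ℝ, E) 𝓘(ℝ, E) (fun b => mulChart I H (b, a)) (chartOne I H) (A.comp L) :=
    HasMFDerivAt.comp (chartOne I H) hc (HasMFDerivAt.comp (chartOne I H) hl hs)
  have h' : HasFDerivAt (fun b => mulChart I H (b, a)) (A.comp L) (chartOne I H) := h.hasFDerivAt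
  exact h'.fderiv

lemma mcChart_leftFactor {a : E} (ha : a ∈ (extChartAt I (1 : H)).target) (v : E) :
    mcChart I H a (leftFactor I H a v) = v := by
  rw [leftFactor_eq I ha]
  have h := mfderiv_extChartAt_symm_apply_mfderiv (I := I) (x₀ := (1 : H))
    ((extChartAt I (1 : H)).map_target ha) (leftTangent I ((extChartAt I (1 : H)).symm a) v)
  rw [(extChartAt I (1 : H)).right_inv ha] at h
  exact (congrArg (leftTangentInv I ((extChartAt I (1 : H)).symm a) : E →L[ℝ] E) h).trans
    (leftTangentInv_comp_leftTangent _ v)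

lemma leftFactor_mcChart {a : E} (ha : a ∈ (extChartAt I (1 : H)).target) (v : E) :
    leftFactor I H a (mcChart I H a v) = v := by
  rw [leftFactor_eq I ha]
  have h := leftTangent_comp_leftTangentInv (I := I) ((extChartAt I (1 : H)).symm a)
    ((mfderiv 𝓘(ℝ, E) I (extChartAt I (1 : H)).symm a : E →L[ℝ] E) v)
  exact (congrArg (mfderiv I 𝓘(ℝ, E) (extChartAt I (1 : H)) ((extChartAt I (1 : H)).symm a) :
    E →L[ℝ] E) h).trans (mfderiv_extChartAt_apply_mfderiv_symm ha v)

lemma mcChart_one : mcChart I H (chartOne I H) = ContinuousLinearMap.id ℝ E := by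
  have h : (extChartAt I (1 : H)).symm (chartOne I H) = 1 := extChartAt_to_inv (1 : H)
  unfold mcChart
  rw [h, leftTangentInv_one]
  exact mfderiv_extChartAt_symm_self (1 : H)

lemma leftFactor_one : leftFactor I H (chartOne I H) = ContinuousLinearMap.id ℝ E := by
  ext v
  have h := leftFactor_mcChart I (mem_extChartAt_target (1 : H)) v
  change leftFactor I H (chartOne I H) (mcChart I H (chartOne I H) v) = v at h
  rw [mcChart_one] at h
  exact h

lemma eventually_chartOne_mem_target :
    ∀ᶠ a in 𝓝 (chartOne I H), a ∈ (extChartAt I (1 : H)).target :=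
  extChartAt_target_mem_nhds (1 : H)

/-- This transfers smoothness from the translations to the Maurer-Cartan form, since inversion of
operators is smooth at the identity. -/
lemma mcChart_eq_inverse {a : E} (ha : a ∈ (extChartAt I (1 : H)).target) :
    mcChart I H a = (leftFactor I H a).inverse := by
  symm
  apply ContinuousLinearMap.inverse_eq
  · ext v; exact leftFactor_mcChart I ha v
  · ext v; exact mcChart_leftFactor I ha v

variable [FiniteDimensional ℝ E]

lemma contDiffAt_mcChart : ContDiffAt ℝ ∞ (mcChart I H) (chartOne I H) := by
  have : CompleteSpace E := FiniteDimensional.complete ℝ E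
  have h : mcChart I H =ᶠ[𝓝 (chartOne I H)]
      ContinuousLinearMap.inverse ∘ leftFactor I H := by
    filter_upwards [eventually_chartOne_mem_target I] with a ha
    exact mcChart_eq_inverse I ha
  refine ContDiffAt.congr_of_eventuallyEq ?_ h
  refine ContDiffAt.comp _ ?_ (contDiffAt_leftFactor I)
  rw [leftFactor_one]
  exact contDiffAt_map_inverse (ContinuousLinearEquiv.refl ℝ E)

/-- Differentiate the constant product of `mcChart` and `leftFactor` at the identity, where both
factors are the identity operator. -/
lemma fderiv_mcChart_apply (ξ η : E) : fderiv ℝ (mcChart I H) (chartOne I H) ξ η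
    = -fderiv ℝ (leftFactor I H) (chartOne I H) ξ η := by
  have h1 := ((contDiffAt_mcChart I (H := H)).differentiableAt infty_ne_zero).hasFDerivAt
  have h2 := ((contDiffAt_leftFactor I (H := H)).differentiableAt infty_ne_zero).hasFDerivAt
  have h3 := h1.clm_comp h2
  have h4 : (fun a => (mcChart I H a).comp (leftFactor I H a)) =ᶠ[𝓝 (chartOne I H)]
      fun _ => ContinuousLinearMap.id ℝ E := by
    filter_upwards [eventually_chartOne_mem_target I] with a ha
    ext v
    exact mcChart_leftFactor I ha v
  have h5 := h3.unique ((hasFDerivAt_const _ _).congr_of_eventuallyEq h4)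
  have h6 := DFunLike.congr_fun (DFunLike.congr_fun h5 ξ) η
  rw [mcChart_one, leftFactor_one] at h6
  simp at h6
  exact eq_neg_of_add_eq_zero_right h6

/-- In the chart, the left-invariant field of `ζ` is `a ↦ leftFactor I H a ζ`; the claim is the
vector space formula for the bracket of two such fields at the identity. -/
lemma bracket_eq_fderiv_leftFactor (ξ η : GroupLieAlgebra I H) :
    ⁅ξ, η⁆ = fderiv ℝ (leftFactor I H) (chartOne I H) ξ η
      - fderiv ℝ (leftFactor I H) (chartOne I H) η ξ := by
  have key : ∀ ζ : E, (fun a : E => (mpullbackWithin 𝓘(ℝ, E) I (extChartAt I (1 : H)).symm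
      (mulInvariantVectorField (I := I) (G := H) ζ) (range I) a : E)) =ᶠ[𝓝 (chartOne I H)]
      fun a => leftFactor I H a ζ := by
    intro ζ
    filter_upwards [eventually_chartOne_mem_target I] with a ha
    rw [leftFactor_eq I ha]
    have hinv : (mfderivWithin 𝓘(ℝ, E) I (extChartAt I (1 : H)).symm (range I) a).inverse
        = mfderiv I 𝓘(ℝ, E) (extChartAt I (1 : H)) ((extChartAt I (1 : H)).symm a) :=
      ContinuousLinearMap.inverse_eq
        (mfderivWithin_extChartAt_symm_comp_mfderiv_extChartAt ha)
        (mfderiv_extChartAt_comp_mfderivWithin_extChartAt_symm ha)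
    rw [mpullbackWithin_apply, hinv]
    rfl
  have hW := ((contDiffAt_leftFactor I (H := H)).differentiableAt infty_ne_zero).hasFDerivAt
  have hd : ∀ ζ v : E, fderiv ℝ (fun a : E => (mpullbackWithin 𝓘(ℝ, E) I
      (extChartAt I (1 : H)).symm (mulInvariantVectorField (I := I) (G := H) ζ) (range I) a : E))
      (chartOne I H) v = fderiv ℝ (leftFactor I H) (chartOne I H) v ζ := by
    intro ζ v
    rw [(key ζ).fderiv_eq, (hW.clm_apply (hasFDerivAt_const ζ _)).fderiv]
    simp
  have hv : ∀ ζ : E, (mpullbackWithin 𝓘(ℝ, E) I (extChartAt I (1 : H)).symm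
      (mulInvariantVectorField (I := I) (G := H) ζ) (range I) (chartOne I H) : E) = ζ := by
    intro ζ
    refine (key ζ).eq_of_nhds.trans ?_
    rw [leftFactor_one]
    rfl
  have hinv : ((mfderiv I 𝓘(ℝ, E) (extChartAt I (1 : H)) (1 : H)).inverse : E →L[ℝ] E)
      = ContinuousLinearMap.id ℝ E := by
    rw [mfderiv_extChartAt_self]
    exact ContinuousLinearMap.inverse_id
  let V : E → E → E := fun ζ => mpullbackWithin 𝓘(ℝ, E) I (extChartAt I (1 : H)).symm
    (mulInvariantVectorField (I := I) (G := H) ζ) (range I)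
  have hs : (extChartAt I (1 : H)).symm ⁻¹' univ ∩ range I = univ := by
    rw [I.range_eq_univ, preimage_univ, univ_inter]
  -- The bracket on the manifold is the chart bracket transported back by the inverse derivative of
  -- the chart, which is the identity at `1`.
  have h1 : ⁅ξ, η⁆ = lieBracketWithin ℝ (V ξ) (V η)
      ((extChartAt I (1 : H)).symm ⁻¹' univ ∩ range I) (chartOne I H) :=
    DFunLike.congr_fun hinv _
  rw [hs, lieBracketWithin_univ] at h1
  refine h1.trans ?_
  have e1 : fderiv ℝ (V η) (chartOne I H) (V ξ (chartOne I H)) = _ :=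
    (congrArg _ (hv ξ)).trans (hd η ξ)
  have e2 : fderiv ℝ (V ξ) (chartOne I H) (V η (chartOne I H)) = _ :=
    (congrArg _ (hv η)).trans (hd ξ η)
  exact congrArg₂ (fun a b : E => a - b) e1 e2

/-- Conjugation by `g⁻¹` is right translation by `g` followed by left translation by `g⁻¹`. -/
lemma Ad_inv_eq (g : H) : (Ad I g⁻¹ : E →L[ℝ] E)
    = (leftTangentInv I g : E →L[ℝ] E).comp (mfderiv I I (fun h : H => h * g) 1 : E →L[ℝ] E) := by
  have h1 : HasMFDerivAt I I (fun h : H => g⁻¹ * h) (1 * g) (leftTangentInv I g : E →L[ℝ] E) := by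
    rw [one_mul]
    exact (mdifferentiableAt_mul_left g⁻¹ g).hasMFDerivAt
  have h := HasMFDerivAt.comp (1 : H) h1 (mdifferentiableAt_mul_right g 1).hasMFDerivAt
  have e : (fun h : H => g⁻¹ * h * g⁻¹⁻¹) = (fun h : H => g⁻¹ * h) ∘ fun h : H => h * g := by
    ext h; simp [mul_assoc]
  unfold Ad
  rw [e]
  exact h.mfderiv

lemma Ad_inv_eq_mcChart_comp_rightFactor {a : E} (ha : a ∈ (extChartAt I (1 : H)).target) :
    (Ad I ((extChartAt I (1 : H)).symm a)⁻¹ : E →L[ℝ] E)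
      = (mcChart I H a).comp (rightFactor I H a) := by
  rw [Ad_inv_eq, rightFactor_eq I ha]
  ext v
  have h := mfderiv_extChartAt_symm_apply_mfderiv (I := I) (x₀ := (1 : H))
    ((extChartAt I (1 : H)).map_target ha)
    ((mfderiv I I (fun h : H => h * (extChartAt I (1 : H)).symm a) 1 : E →L[ℝ] E) v)
  rw [(extChartAt I (1 : H)).right_inv ha] at h
  exact (congrArg (leftTangentInv I ((extChartAt I (1 : H)).symm a) : E →L[ℝ] E) h).symm

lemma rightFactor_one : rightFactor I H (chartOne I H) = ContinuousLinearMap.id ℝ E := by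
  have ha := mem_extChartAt_target (I := I) (1 : H)
  have h := rightFactor_eq I ha
  have h1 : (extChartAt I (1 : H)).symm (extChartAt I (1 : H) 1) = 1 := extChartAt_to_inv (1 : H)
  have h2 : (fun h : H => h * 1) = id := by ext; simp
  rw [h1, h2, mfderiv_id, mfderiv_extChartAt_self] at h
  exact h

/-- The product rule at the identity: the Maurer-Cartan factor contributes minus the mixed second
derivative, and the right factor contributes it with exchanged arguments. -/
lemma fderiv_mcChart_rightFactor (ξ η : E) :
    fderiv ℝ (fun a => mcChart I H a (rightFactor I H a η)) (chartOne I H) ξ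
      = -(fderiv ℝ (leftFactor I H) (chartOne I H) ξ η
        - fderiv ℝ (leftFactor I H) (chartOne I H) η ξ) := by
  have h1 := ((contDiffAt_mcChart I (H := H)).differentiableAt infty_ne_zero).hasFDerivAt
  have h2 := ((contDiffAt_rightFactor I (H := H)).differentiableAt infty_ne_zero).hasFDerivAt
  have h3 := h1.clm_apply (h2.clm_apply (hasFDerivAt_const η _))
  refine (DFunLike.congr_fun h3.fderiv ξ).trans ?_
  rw [mcChart_one, rightFactor_one]
  simp [fderiv_rightFactor_apply, fderiv_mcChart_apply, sub_eq_add_neg]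

/-- The map `g ↦ Ad_{g⁻¹} η`. -/
def adInv (η : GroupLieAlgebra I H) (g : H) : E := Ad I g⁻¹ η

/-- The derivative at the identity of `g ↦ Ad_{g⁻¹} η` in the direction `ξ` is `-[ξ, η]`. -/
theorem hasMFDerivAt_adInv (η : GroupLieAlgebra I H) :
    ∃ A : E →L[ℝ] E, HasMFDerivAt I 𝓘(ℝ, E) (adInv I η : H → E) (1 : H) A ∧
      ∀ ξ : GroupLieAlgebra I H, A ξ = -⁅ξ, η⁆ := by
  have h1 := (contDiffAt_mcChart I (H := H)).differentiableAt infty_ne_zero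
  have h2 := (contDiffAt_rightFactor I (H := H)).differentiableAt infty_ne_zero
  have h3 : DifferentiableAt ℝ (fun a => mcChart I H a (rightFactor I H a (η : E)))
      (chartOne I H) :=
    h1.clm_apply (h2.clm_apply (differentiableAt_const (η : E)))
  refine ⟨fderiv ℝ (fun a => mcChart I H a (rightFactor I H a (η : E))) (chartOne I H), ?_,
    fun ξ => ?_⟩
  · have h4 : HasMFDerivAt I 𝓘(ℝ, E) (extChartAt I (1 : H)) 1 (ContinuousLinearMap.id ℝ E) := by
      have := (mdifferentiableAt_extChartAt (I := I) (mem_chart_source X (1 : H))).hasMFDerivAt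
      rw [mfderiv_extChartAt_self] at this
      exact this
    have h5 := HasMFDerivAt.comp (1 : H) h3.hasFDerivAt.hasMFDerivAt h4
    refine (HasMFDerivAt.congr_of_eventuallyEq h5 ?_)
    filter_upwards [extChartAt_source_mem_nhds (I := I) (1 : H)] with g hg
    have := Ad_inv_eq_mcChart_comp_rightFactor I ((extChartAt I (1 : H)).map_source hg)
    rw [(extChartAt I (1 : H)).left_inv hg] at this
    exact DFunLike.congr_fun this η
  · refine (fderiv_mcChart_rightFactor I ξ η).trans ?_
    exact congrArg (fun v : E => -v) (bracket_eq_fderiv_leftFactor I ξ η).symm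

end LieGroupChart

/-! ### The canonical one-form in charts of the cotangent bundle. -/

section Cotangent

variable {E : Type*} [NormedAddCommGroup E] [NormedSpace ℝ E]
  {X : Type*} [TopologicalSpace X] {I : ModelWithCorners ℝ E X}
  {M : Type*} [TopologicalSpace M] [ChartedSpace X M] [IsManifold I ∞ M]

/-- Covectors take values in a trivial line bundle, so only the trivialization of the tangent bundle
contributes. -/
lemma inCoordinates_dual (x₀ x : M) (α : TangentSpace I x →L[ℝ] ℝ) :
    ContinuousLinearMap.inCoordinates E (TangentSpace I) ℝ (fun _ : M => ℝ) x₀ x x₀ x α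
      = α.comp ((trivializationAt E (TangentSpace I) x₀).symmL ℝ x) := by
  unfold ContinuousLinearMap.inCoordinates
  have h := Bundle.Trivial.continuousLinearMapAt_trivialization ℝ M ℝ x
  change (ContinuousLinearMap.comp ((Bundle.Trivial.trivialization M ℝ).continuousLinearMapAt ℝ x)
    _) = _
  rw [h]
  rfl

variable [I.Boundaryless]

lemma inCoordinates_dual_apply {x₀ x : M} (hx : x ∈ (extChartAt I x₀).source)
    (α : TangentSpace I x →L[ℝ] ℝ) (v : E) :
    ContinuousLinearMap.inCoordinates E (TangentSpace I) ℝ (fun _ : M => ℝ) x₀ x x₀ x α v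
      = α ((mfderiv 𝓘(ℝ, E) I (extChartAt I x₀).symm (extChartAt I x₀ x) : E →L[ℝ] E) v) := by
  rw [inCoordinates_dual]
  have h := TangentBundle.symmL_trivializationAt (I := I) (x₀ := x₀) (x := x)
    (by rwa [← extChartAt_source (I := I)])
  rw [I.range_eq_univ, mfderivWithin_univ] at h
  exact congrArg α (DFunLike.congr_fun h v)

lemma contMDiff_cotangent_proj :
    ContMDiff (cotangentModel I) I ∞ (fun β : CotangentBundle I M => β.proj) :=
  Bundle.contMDiff_proj _

lemma extChartAt_cotangent_apply (α₀ β : CotangentBundle I M) :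
    extChartAt (cotangentModel I) α₀ β = (extChartAt I α₀.proj β.proj,
      ContinuousLinearMap.inCoordinates E (TangentSpace I) ℝ (fun _ : M => ℝ)
        α₀.proj β.proj α₀.proj β.proj β.snd) := by
  rw [FiberBundle.extChartAt]
  rfl

/-- This is `θ = p dq`: near `a` the bundle projection is the first coordinate followed by the
inverse base chart, and the derivative of that inverse chart is exactly what turns a covector into
its coordinate `p`. -/
lemma chartRep_canonicalOneForm (α₀ : CotangentBundle I M) {a : E × (E →L[ℝ] ℝ)}
    (ha : a ∈ (extChartAt (cotangentModel I) α₀).target) (v : Fin 1 → E × (E →L[ℝ] ℝ)) :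
    chartRep (cotangentModel I) (canonicalOneForm I M) α₀ a v = a.2 (v 0).1 := by
  set β : CotangentBundle I M := (extChartAt (cotangentModel I) α₀).symm a with hβ
  have hβa : extChartAt (cotangentModel I) α₀ β = a :=
    (extChartAt (cotangentModel I) α₀).right_inv ha
  have hsrc : β ∈ (extChartAt (cotangentModel I) α₀).source :=
    (extChartAt (cotangentModel I) α₀).map_target ha
  have hproj : β.proj ∈ (extChartAt I α₀.proj).source := by
    rw [FiberBundle.extChartAt] at hsrc
    simp only [mfld_simps] at hsrc
    simpa using hsrc.1
  rw [extChartAt_cotangent_apply] at hβa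
  have ha1 : extChartAt I α₀.proj β.proj = a.1 := congrArg Prod.fst hβa
  have ha2 : ∀ w, a.2 w
      = β.snd ((mfderiv 𝓘(ℝ, E) I (extChartAt I α₀.proj).symm a.1 : E →L[ℝ] E) w) := by
    intro w
    rw [← ha1, ← inCoordinates_dual_apply hproj, ← hβa]
  have ha1t : a.1 ∈ (extChartAt I α₀.proj).target := by
    rw [← ha1]
    exact (extChartAt I α₀.proj).map_source hproj
  have hΦ : MDifferentiableAt 𝓘(ℝ, E × (E →L[ℝ] ℝ)) (cotangentModel I)
      (extChartAt (cotangentModel I) α₀).symm a :=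
    (contMDiffAt_extChartAt_symm ha).mdifferentiableAt infty_ne_zero
  have hp : MDifferentiableAt (cotangentModel I) I (fun β : CotangentBundle I M => β.proj) β :=
    contMDiff_cotangent_proj.contMDiffAt.mdifferentiableAt infty_ne_zero
  have h1 : HasMFDerivAt 𝓘(ℝ, E × (E →L[ℝ] ℝ)) I
      (fun b => ((extChartAt (cotangentModel I) α₀).symm b).proj) a _ :=
    HasMFDerivAt.comp a hp.hasMFDerivAt hΦ.hasMFDerivAt
  have h2 : HasMFDerivAt 𝓘(ℝ, E × (E →L[ℝ] ℝ)) I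
      (fun b : E × (E →L[ℝ] ℝ) => (extChartAt I α₀.proj).symm b.1) a
      ((mfderiv 𝓘(ℝ, E) I (extChartAt I α₀.proj).symm a.1 : E →L[ℝ] E).comp
        (ContinuousLinearMap.fst ℝ E (E →L[ℝ] ℝ))) :=
    HasMFDerivAt.comp a (I' := 𝓘(ℝ, E))
      ((contMDiffAt_extChartAt_symm ha1t).mdifferentiableAt infty_ne_zero).hasMFDerivAt
      (hasFDerivAt_fst.hasMFDerivAt)
  have h3 : (fun b => ((extChartAt (cotangentModel I) α₀).symm b).proj) =ᶠ[𝓝 a]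
      fun b : E × (E →L[ℝ] ℝ) => (extChartAt I α₀.proj).symm b.1 := by
    filter_upwards [extChartAt_target_mem_nhds' ha] with b hb
    have e := (extChartAt (cotangentModel I) α₀).right_inv hb
    have hs := (extChartAt (cotangentModel I) α₀).map_target hb
    rw [extChartAt_cotangent_apply] at e
    rw [FiberBundle.extChartAt] at hs
    have e1 : extChartAt I α₀.proj ((extChartAt (cotangentModel I) α₀).symm b).proj = b.1 :=
      congrArg Prod.fst e
    rw [← e1, (extChartAt I α₀.proj).left_inv]
    rw [FiberBundle.extChartAt]
    simp only [mfld_simps] at hs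
    simpa using hs.1
  have h4 := hasMFDerivAt_unique h1 (h2.congr_of_eventuallyEq h3)
  have h5 := DFunLike.congr_fun h4 (v 0)
  rw [ha2]
  exact congrArg β.snd h5

lemma smoothFormAt_canonicalOneForm [FiniteDimensional ℝ E] (α₀ : CotangentBundle I M) :
    SmoothFormAt (cotangentModel I) (canonicalOneForm I M) α₀ := by
  unfold SmoothFormAt
  rw [contDiffAt_alternating_iff]
  intro v
  have h : ContDiffAt ℝ ∞ (fun a : E × (E →L[ℝ] ℝ) => a.2 (v 0).1)
      (extChartAt (cotangentModel I) α₀ α₀) :=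
    contDiffAt_snd.clm_apply contDiffAt_const
  refine h.congr_of_eventuallyEq ?_
  filter_upwards [extChartAt_target_mem_nhds (I := cotangentModel I) α₀] with a ha
  exact chartRep_canonicalOneForm α₀ ha v

end Cotangent

/-! ### Smoothness of the inverse left trivialization and of the inverse shift. -/

section BodyMap

variable {E : Type*} [NormedAddCommGroup E] [NormedSpace ℝ E]
  {X : Type*} [TopologicalSpace X] {I : ModelWithCorners ℝ E X} [I.Boundaryless]
  {H : Type*} [TopologicalSpace H] [ChartedSpace X H] [Group H] [LieGroup I ∞ H]
  {F : Type*} [NormedAddCommGroup F] [NormedSpace ℝ F]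
  {Y : Type*} [TopologicalSpace Y] {J : ModelWithCorners ℝ F Y}
  {P : Type*} [TopologicalSpace P] [ChartedSpace Y P]

/-- The left Maurer-Cartan form in the trivialization of the tangent bundle around `g₀`. -/
def mcCoord (I : ModelWithCorners ℝ E X) {H : Type*} [TopologicalSpace H] [ChartedSpace X H]
    [Group H] [LieGroup I ∞ H] (g₀ g : H) : E →L[ℝ] E :=
  (leftTangentInv I g : E →L[ℝ] E).comp
    ((trivializationAt E (TangentSpace I) g₀).symmL ℝ g : E →L[ℝ] E)

/-- The Maurer-Cartan form is the derivative in `h`, at `h = g`, of the smooth map `(g, h) ↦ g⁻¹ *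
h`, and derivatives of smooth families are smooth. -/
lemma contMDiffAt_mcCoord (g₀ : H) :
    ContMDiffAt I 𝓘(ℝ, E →L[ℝ] E) ∞ (mcCoord I g₀) g₀ := by
  have := LieGroup.toContMDiffMul (I := I) (n := ∞) (G := H)
  have hf : ContMDiffAt (I.prod I) I ∞ (Function.uncurry fun g h : H => g⁻¹ * h) (g₀, g₀) :=
    (((contMDiff_inv I ∞).comp contMDiff_fst).mul contMDiff_snd).contMDiffAt
  have h := ContMDiffAt.mfderiv (m := ∞) (fun g h : H => g⁻¹ * h) (fun g => g) hf
    contMDiffAt_id le_rfl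
  refine h.congr_of_eventuallyEq (Eventually.of_forall fun g => ?_)
  unfold inTangentCoordinates ContinuousLinearMap.inCoordinates
  -- The target points `g₀⁻¹ * g₀` and `g⁻¹ * g` occur in the types; quantifying over points equal
  -- to `1` allows substitution.
  have e : ∀ k₁ k₂ : H, k₁ = 1 → k₂ = 1 →
      ((trivializationAt E (TangentSpace I) k₁).continuousLinearMapAt ℝ k₂ : E →L[ℝ] E)
        = ContinuousLinearMap.id ℝ E := by
    rintro _ _ rfl rfl
    rw [TangentBundle.continuousLinearMapAt_trivializationAt (mem_chart_source X (1 : H)),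
      mfderiv_extChartAt_self]
    rfl
  have e' := e (g₀⁻¹ * g₀) (g⁻¹ * g) (inv_mul_cancel _) (inv_mul_cancel _)
  symm
  ext v
  exact DFunLike.congr_fun e' _

/-- The inverse left trivialization `(g, μ) ↦ μ ∘ T L_{g⁻¹}` of the cotangent bundle. -/
def trivInv (I : ModelWithCorners ℝ E X) {H : Type*} [TopologicalSpace H] [ChartedSpace X H]
    [Group H] [LieGroup I ∞ H] (y : H × (E →L[ℝ] ℝ)) : CotangentBundle I H :=
  ⟨y.1, ContinuousLinearMap.comp (M₂ := E) y.2 (leftTangentInv I y.1)⟩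

lemma contMDiff_trivInv :
    ContMDiff (I.prod 𝓘(ℝ, E →L[ℝ] ℝ)) (cotangentModel I) ∞
      (trivInv I : H × (E →L[ℝ] ℝ) → CotangentBundle I H) := by
  intro y₀
  rw [contMDiffAt_hom_bundle]
  refine ⟨contMDiffAt_fst, ?_⟩
  have h1 : ContMDiffAt (I.prod 𝓘(ℝ, E →L[ℝ] ℝ)) 𝓘(ℝ, E →L[ℝ] E) ∞
      (fun y : H × (E →L[ℝ] ℝ) => mcCoord I y₀.1 y.1) y₀ :=
    ContMDiffAt.comp y₀ (contMDiffAt_mcCoord y₀.1) contMDiffAt_fst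
  have h2 : ContMDiffAt (I.prod 𝓘(ℝ, E →L[ℝ] ℝ)) 𝓘(ℝ, E →L[ℝ] ℝ) ∞
      (fun y : H × (E →L[ℝ] ℝ) => y.2) y₀ := contMDiffAt_snd
  refine (h2.clm_comp h1).congr_of_eventuallyEq (Eventually.of_forall fun y => ?_)
  exact inCoordinates_dual y₀.1 y.1 _

variable [MulAction H P] [ContMDiffSMul I J ∞ H P]

/-- Only the inverse is needed, since the push-forward is a pull-back along it; the same holds for
`contMDiff_shiftMap_symm`. -/
lemma contMDiff_bodyMap_symm :
    ContMDiff (bodyModel I J) ((cotangentModel I).prod J) ∞ (bodyMap I H P).symm := by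
  have h1 : ContMDiff (bodyModel I J) (cotangentModel I) ∞
      (fun y : H × (LieDual I H × P) => trivInv I (y.1, y.2.1)) :=
    contMDiff_trivInv.comp (contMDiff_fst.prodMk (contMDiff_fst.comp contMDiff_snd))
  have h2 : ContMDiff (bodyModel I J) J ∞ (fun y : H × (LieDual I H × P) => y.1 • y.2.2) :=
    (contMDiff_smul (I := I) (I' := J)).comp
      (contMDiff_fst.prodMk (contMDiff_snd.comp contMDiff_snd))
  exact h1.prodMk h2

lemma contMDiff_shiftMap_symm {φ : H × P → LieDual I H}
    (hφ : ContMDiff (I.prod J) 𝓘(ℝ, E →L[ℝ] ℝ) ∞ φ) :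
    ContMDiff (bodyModel I J) (bodyModel I J) ∞ (shiftMap I φ).symm := by
  have h1 : ContMDiff (bodyModel I J) (I.prod J) ∞
      (fun y : H × (LieDual I H × P) => ((1 : H), y.2.2)) :=
    contMDiff_const.prodMk (contMDiff_snd.comp contMDiff_snd)
  have h2 : ContMDiff (bodyModel I J) 𝓘(ℝ, E →L[ℝ] ℝ) ∞
      (fun y : H × (LieDual I H × P) => y.2.1) := contMDiff_fst.comp contMDiff_snd
  exact contMDiff_fst.prodMk ((h2.add (hφ.comp h1)).prodMk (contMDiff_snd.comp contMDiff_snd))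

end BodyMap

/-! ### Evaluating pull-backs on vectors. -/

section

variable {E : Type*} [NormedAddCommGroup E] [NormedSpace ℝ E]
  {X : Type*} [TopologicalSpace X] {I : ModelWithCorners ℝ E X}
  {M : Type*} [TopologicalSpace M] [ChartedSpace X M]
  {F : Type*} [NormedAddCommGroup F] [NormedSpace ℝ F]
  {Y : Type*} [TopologicalSpace Y] {J : ModelWithCorners ℝ F Y}
  {N : Type*} [TopologicalSpace N] [ChartedSpace Y N] {k : ℕ}

lemma pullback_apply_of_eq {f : M → N} {Ω : DiffForm J N k} {x : M} {y : N} {A : E →L[ℝ] F}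
    (h : f x = y) (hA : (mfderiv I J f x : E →L[ℝ] F) = A) (v : Fin k → E) :
    (pullback I J f Ω x : E [⋀^Fin k]→L[ℝ] ℝ) v
      = (Ω y : F [⋀^Fin k]→L[ℝ] ℝ) (fun i => A (v i)) := by
  subst h hA
  rfl

/-- The tautological property of `θ`. It avoids differentiating the fibre component of `f`: only the
base map enters. -/
lemma pullback_canonicalOneForm [I.Boundaryless] [IsManifold I ∞ M] {f : N → CotangentBundle I M} {x : N}
    (hf : MDifferentiableAt J (cotangentModel I) f x) (v : Fin 1 → TangentSpace J x) :
    pullback J (cotangentModel I) f (canonicalOneForm I M) x v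
      = (f x).snd (mfderiv J I (fun y => (f y).proj) x (v 0)) := by
  have hp : MDifferentiableAt (cotangentModel I) I
      (fun β : CotangentBundle I M => β.proj) (f x) :=
    contMDiff_cotangent_proj.contMDiffAt.mdifferentiableAt infty_ne_zero
  have h := (HasMFDerivAt.comp x hp.hasMFDerivAt hf.hasMFDerivAt).mfderiv
  exact congrArg (f x).snd (DFunLike.congr_fun h (v 0)).symm

end

/-! ### The shifted form as `-dΘ - s^*B`: smoothness, closedness and invariance. -/

section Shifted

variable {E : Type*} [NormedAddCommGroup E] [NormedSpace ℝ E]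
  {X : Type*} [TopologicalSpace X] {I : ModelWithCorners ℝ E X}
  {H : Type*} [TopologicalSpace H] [ChartedSpace X H] [Group H] [LieGroup I ∞ H]
  {F : Type*} [NormedAddCommGroup F] [NormedSpace ℝ F]
  {Y : Type*} [TopologicalSpace Y] {J : ModelWithCorners ℝ F Y}
  {P : Type*} [TopologicalSpace P] [ChartedSpace Y P] [MulAction H P]

/-- The map `(g, μ, x) ↦ (μ + φ(e, x)) ∘ T L_{g⁻¹}` to the cotangent bundle. -/
def momentumMap (I : ModelWithCorners ℝ E X) {H : Type*} [TopologicalSpace H] [ChartedSpace X H]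
    [Group H] [LieGroup I ∞ H] (φ : H × P → LieDual I H) (z : H × (LieDual I H × P)) :
    CotangentBundle I H :=
  trivInv I (z.1, z.2.1 + φ (1, z.2.2))

/-- The map `(g, μ, x) ↦ (g, g · x)`. -/
def spatialMap (z : H × ((E →L[ℝ] ℝ) × P)) : H × P := (z.1, z.1 • z.2.2)

variable (I J) in
/-- The one-form `(g, μ, x) ↦ ⟨μ + φ(e, x), λ⟩`, with `λ` the left Maurer-Cartan form. -/
def bodyOneForm (φ : H × P → LieDual I H) :
    DiffForm (bodyModel I J) (H × (LieDual I H × P)) 1 :=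
  pullback (bodyModel I J) (cotangentModel I) (momentumMap I φ) (canonicalOneForm I H)

lemma mfderiv_bodyAct (h : H) (z : H × (LieDual I H × P)) :
    HasMFDerivAt (bodyModel I J) (bodyModel I J) (bodyAct I h : H × (LieDual I H × P) → _) z
      (((mfderiv I I (fun k : H => h * k) z.1 : E →L[ℝ] E).comp
        (ContinuousLinearMap.fst ℝ E ((E →L[ℝ] ℝ) × F))).prod
        (ContinuousLinearMap.snd ℝ E ((E →L[ℝ] ℝ) × F))) :=
  (HasMFDerivAt.comp z (mdifferentiableAt_mul_left h z.1).hasMFDerivAt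
    (hasMFDerivAt_fst z)).prodMk (hasMFDerivAt_snd z)

lemma contMDiff_bodyAct (h : H) :
    ContMDiff (bodyModel I J) (bodyModel I J) ∞ (bodyAct I h : H × (LieDual I H × P) → _) :=
  ((contMDiff_mul_left (I := I) (n := ∞)).comp contMDiff_fst).prodMk contMDiff_snd

/-- Left invariance of the Maurer-Cartan form, by the chain rule for `(hg)⁻¹(hk) = g⁻¹k`. -/
lemma leftTangentInv_mul (h g : H) (v : E) :
    (leftTangentInv I (h * g) : E →L[ℝ] E) ((mfderiv I I (fun k : H => h * k) g : E →L[ℝ] E) v)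
      = leftTangentInv I g v := by
  have h1 := (HasMFDerivAt.comp g (mdifferentiableAt_mul_left (I := I) (h * g)⁻¹ (h * g)).hasMFDerivAt
    (mdifferentiableAt_mul_left (I := I) h g).hasMFDerivAt).mfderiv
  have h2 : (fun k : H => (h * g)⁻¹ * k) ∘ (fun k : H => h * k) = fun k => g⁻¹ * k := by
    ext k; simp [mul_assoc]
  rw [h2] at h1
  exact (DFunLike.congr_fun h1 v).symm

variable [I.Boundaryless] [FiniteDimensional ℝ E] [J.Boundaryless] [FiniteDimensional ℝ F]
  [IsManifold J ∞ P] [ContMDiffSMul I J ∞ H P]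

lemma contMDiff_momentumMap {φ : H × P → LieDual I H}
    (hφ : ContMDiff (I.prod J) 𝓘(ℝ, E →L[ℝ] ℝ) ∞ φ) :
    ContMDiff (bodyModel I J) (cotangentModel I) ∞ (momentumMap I φ) := by
  have h1 : ContMDiff (bodyModel I J) (I.prod J) ∞
      (fun y : H × (LieDual I H × P) => ((1 : H), y.2.2)) :=
    contMDiff_const.prodMk (contMDiff_snd.comp contMDiff_snd)
  have h2 : ContMDiff (bodyModel I J) 𝓘(ℝ, E →L[ℝ] ℝ) ∞
      (fun y : H × (LieDual I H × P) => y.2.1) := contMDiff_fst.comp contMDiff_snd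
  exact contMDiff_trivInv.comp (contMDiff_fst.prodMk (h2.add (hφ.comp h1)))

lemma contMDiff_spatialMap :
    ContMDiff (bodyModel I J) (I.prod J) ∞ (spatialMap : H × ((E →L[ℝ] ℝ) × P) → H × P) :=
  contMDiff_fst.prodMk ((contMDiff_smul (I := I) (I' := J)).comp
    (contMDiff_fst.prodMk (contMDiff_snd.comp contMDiff_snd)))

lemma bodyOneForm_apply {φ : H × P → LieDual I H}
    (hφ : ContMDiff (I.prod J) 𝓘(ℝ, E →L[ℝ] ℝ) ∞ φ) (z : H × (LieDual I H × P))
    (v : Fin 1 → E × ((E →L[ℝ] ℝ) × F)) :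
    bodyOneForm I J φ z v = (z.2.1 + φ (1, z.2.2)) (leftTangentInv I z.1 (v 0).1) := by
  have h := pullback_canonicalOneForm
    ((contMDiff_momentumMap hφ).contMDiffAt.mdifferentiableAt infty_ne_zero (x := z)) v
  have h2 : (mfderiv (bodyModel I J) I (fun y => (momentumMap I φ y).proj) z :
      E × ((E →L[ℝ] ℝ) × F) →L[ℝ] E) = ContinuousLinearMap.fst ℝ E ((E →L[ℝ] ℝ) × F) :=
    (hasMFDerivAt_fst (I := I) (I' := 𝓘(ℝ, E →L[ℝ] ℝ).prod J) z).mfderiv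
  refine h.trans ?_
  exact congrArg (momentumMap I φ z).snd (DFunLike.congr_fun h2 (v 0))

lemma smoothFormAt_bodyOneForm {φ : H × P → LieDual I H}
    (hφ : ContMDiff (I.prod J) 𝓘(ℝ, E →L[ℝ] ℝ) ∞ φ) (z : H × (LieDual I H × P)) :
    SmoothFormAt (bodyModel I J) (bodyOneForm I J φ) z :=
  (smoothFormAt_canonicalOneForm _).pullback (contMDiff_momentumMap hφ).contMDiffAt

lemma bodyOneForm_invariant {φ : H × P → LieDual I H}
    (hφ : ContMDiff (I.prod J) 𝓘(ℝ, E →L[ℝ] ℝ) ∞ φ) (h : H) :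
    pullback (bodyModel I J) (bodyModel I J) (bodyAct I h) (bodyOneForm I J φ)
      = bodyOneForm I J φ := by
  funext z
  refine ContinuousAlternatingMap.ext fun v => ?_
  refine Eq.trans ?_ (bodyOneForm_apply hφ z v).symm
  refine (pullback_apply_of_eq rfl (mfderiv_bodyAct h z).mfderiv v).trans ?_
  refine (bodyOneForm_apply hφ _ _).trans ?_
  exact congrArg (z.2.1 + φ (1, z.2.2)) (leftTangentInv_mul h z.1 (v 0).1)

/-- Composing the two inverse maps with the projections of `T^*H × P` gives `momentumMap` and
`spatialMap`; naturality of `d` moves the first pull-back inside the exterior derivative. -/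
theorem shiftedForm_eq {B : DiffForm (I.prod J) (H × P) 2} {φ : H × P → LieDual I H}
    (hφ : ContMDiff (I.prod J) 𝓘(ℝ, E →L[ℝ] ℝ) ∞ φ) :
    shiftedForm I J B φ = fun z => -extD (bodyModel I J) (bodyOneForm I J φ) z
      - pullback (bodyModel I J) (I.prod J) spatialMap B z := by
  funext z
  have hS := (contMDiff_shiftMap_symm hφ).contMDiffAt.mdifferentiableAt infty_ne_zero (x := z)
  have hΛ := (contMDiff_bodyMap_symm (I := I) (J := J) (H := H) (P := P)).contMDiffAt.mdifferentiableAt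
    infty_ne_zero (x := (shiftMap I φ).symm z)
  have hΨ : MDifferentiableAt (bodyModel I J) ((cotangentModel I).prod J)
      ((bodyMap I H P).symm ∘ (shiftMap I φ).symm) z := hΛ.comp z hS
  have h1 : shiftedForm I J B φ z = pullback (bodyModel I J) ((cotangentModel I).prod J)
      ((bodyMap I H P).symm ∘ (shiftMap I φ).symm) (magneticForm I J B) z :=
    (pullback_comp hΛ hS).symm
  have hfst : MDifferentiableAt ((cotangentModel I).prod J) (cotangentModel I)
      (Prod.fst : CotangentBundle I H × P → CotangentBundle I H)
      (((bodyMap I H P).symm ∘ (shiftMap I φ).symm) z) := mdifferentiableAt_fst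
  have hπ : MDifferentiableAt ((cotangentModel I).prod J) (I.prod J)
      (fun y : CotangentBundle I H × P => (y.1.proj, y.2))
      (((bodyMap I H P).symm ∘ (shiftMap I φ).symm) z) :=
    ((contMDiff_cotangent_proj.comp contMDiff_fst).prodMk
      contMDiff_snd).contMDiffAt.mdifferentiableAt infty_ne_zero
  have h2 := pullback_comp (Ω := canonicalForm I H) hfst hΨ
  have h3 := pullback_comp (Ω := B) hπ hΨ
  have h4 := extD_pullback (contMDiff_momentumMap hφ).contMDiffAt
    (smoothFormAt_canonicalOneForm (momentumMap I φ z))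
  have h5 : pullback (bodyModel I J) (cotangentModel I)
      (Prod.fst ∘ (bodyMap I H P).symm ∘ (shiftMap I φ).symm) (canonicalForm I H) z
      = -extD (bodyModel I J) (bodyOneForm I J φ) z := congrArg (fun β => -β) h4.symm
  rw [h1]
  exact congrArg₂ (fun β γ => β - γ) (h2.symm.trans h5) h3.symm

lemma smoothFormAt_shiftedForm {B : DiffForm (I.prod J) (H × P) 2} {φ : H × P → LieDual I H}
    (hB : IsSmoothForm (I.prod J) B)
    (hφ : ContMDiff (I.prod J) 𝓘(ℝ, E →L[ℝ] ℝ) ∞ φ) (z : H × (LieDual I H × P)) :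
    SmoothFormAt (bodyModel I J) (shiftedForm I J B φ) z := by
  rw [shiftedForm_eq hφ]
  exact (smoothFormAt_extD (smoothFormAt_bodyOneForm hφ) z).neg.sub
    ((isSmoothForm_iff.1 hB _).pullback contMDiff_spatialMap.contMDiffAt)

lemma extD_shiftedForm {B : DiffForm (I.prod J) (H × P) 2} {φ : H × P → LieDual I H}
    (hB : IsSmoothForm (I.prod J) B) (hB' : ∀ z, extD (I.prod J) B z = 0)
    (hφ : ContMDiff (I.prod J) 𝓘(ℝ, E →L[ℝ] ℝ) ∞ φ) (z : H × (LieDual I H × P)) :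
    extD (bodyModel I J) (shiftedForm I J B φ) z = 0 := by
  have hq := (isSmoothForm_iff.1 hB (spatialMap z)).pullback
    (contMDiff_spatialMap (I := I) (J := J)).contMDiffAt
  rw [shiftedForm_eq hφ, extD_sub (smoothFormAt_extD (smoothFormAt_bodyOneForm hφ) z).neg hq,
    extD_neg, extD_extD (smoothFormAt_bodyOneForm hφ),
    extD_pullback contMDiff_spatialMap.contMDiffAt (isSmoothForm_iff.1 hB _)]
  unfold pullback
  rw [hB']
  ext v
  simp

/-- Both summands are invariant: `Θ` because `λ` is, and the pull-back of `B` because `spatialMap`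
intertwines `bodyAct` with `diagAct`. -/
theorem shiftedForm_invariant {B : DiffForm (I.prod J) (H × P) 2} {φ : H × P → LieDual I H}
    (hB : ∀ h : H, pullback (I.prod J) (I.prod J) (diagAct h : H × P → H × P) B = B)
    (hφ : ContMDiff (I.prod J) 𝓘(ℝ, E →L[ℝ] ℝ) ∞ φ) (h : H) :
    pullback (bodyModel I J) (bodyModel I J) (bodyAct I h) (shiftedForm I J B φ)
      = shiftedForm I J B φ := by
  have hd : ContMDiff (I.prod J) (I.prod J) ∞ (diagAct h : H × P → H × P) :=
    ((contMDiff_mul_left (I := I) (n := ∞)).comp contMDiff_fst).prodMk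
      ((contMDiff_smul (I := I) (I' := J)).comp (contMDiff_const.prodMk contMDiff_snd))
  rw [shiftedForm_eq hφ]
  funext z
  have hz := contMDiff_bodyAct (J := J) (P := P) (I := I) h
  have h1 := extD_pullback (hz.contMDiffAt (x := z))
    (smoothFormAt_bodyOneForm hφ (bodyAct I h z))
  rw [bodyOneForm_invariant hφ] at h1
  have h2 := pullback_comp (Ω := B) (contMDiff_spatialMap.contMDiffAt.mdifferentiableAt infty_ne_zero)
    (hz.contMDiffAt.mdifferentiableAt infty_ne_zero (x := z))
  have h3 := pullback_comp (Ω := B) (hd.contMDiffAt.mdifferentiableAt infty_ne_zero)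
    ((contMDiff_spatialMap (I := I) (J := J)).contMDiffAt.mdifferentiableAt infty_ne_zero (x := z))
  rw [hB] at h3
  have h4 : (spatialMap : H × ((E →L[ℝ] ℝ) × P) → H × P) ∘ (bodyAct I h)
      = (diagAct h) ∘ spatialMap := by
    funext y
    exact Prod.ext rfl (mul_smul h y.1 y.2.2)
  rw [h4, h3] at h2
  exact congrArg₂ (fun β γ => -β - γ) h1.symm h2.symm

/-- By invariance, the shifted form is determined by its values over the identity. -/
lemma shiftedForm_apply {B : DiffForm (I.prod J) (H × P) 2} {φ : H × P → LieDual I H}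
    (hB : ∀ h : H, pullback (I.prod J) (I.prod J) (diagAct h : H × P → H × P) B = B)
    (hφ : ContMDiff (I.prod J) 𝓘(ℝ, E →L[ℝ] ℝ) ∞ φ) (z : H × (LieDual I H × P))
    (v : Fin 2 → E × ((E →L[ℝ] ℝ) × F)) :
    shiftedForm I J B φ z v
      = shiftedForm I J B φ ((1 : H), z.2)
        (fun i => ((leftTangentInv I z.1 (v i).1, (v i).2) : E × ((E →L[ℝ] ℝ) × F))) := by
  have h1 := congrFun (shiftedForm_invariant (B := B) hB hφ z.1⁻¹) z
  have h2 := DFunLike.congr_fun h1 v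
  refine h2.symm.trans ?_
  exact pullback_apply_of_eq (f := bodyAct I z.1⁻¹) (Ω := shiftedForm I J B φ) (y := ((1 : H), z.2))
    (Prod.ext (inv_mul_cancel z.1) rfl)
    (mfderiv_bodyAct z.1⁻¹ z).mfderiv v

end Shifted

/-! ### Scalar derivatives and exterior derivatives of one-forms on given vectors. -/

section

variable {E : Type*} [NormedAddCommGroup E] [NormedSpace ℝ E]
  {X : Type*} [TopologicalSpace X] {I : ModelWithCorners ℝ E X}
  {M : Type*} [TopologicalSpace M] [ChartedSpace X M]
  {F : Type*} [NormedAddCommGroup F] [NormedSpace ℝ F]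

lemma mvfderiv_apply_of_hasMFDerivAt {f : M → F} {x : M} {A : E →L[ℝ] F}
    (h : HasMFDerivAt I 𝓘(ℝ, F) f x A) (w : E) : mvfderiv I f x w = A w :=
  DFunLike.congr_fun h.mfderiv w

end

section

variable {V : Type*} [NormedAddCommGroup V] [NormedSpace ℝ V] [FiniteDimensional ℝ V]

lemma extDeriv_one_apply {β : V → V [⋀^Fin 1]→L[ℝ] ℝ} {c : V} (h : DifferentiableAt ℝ β c)
    (w w' : V) : extDeriv β c ![w, w']
      = fderiv ℝ (fun a => β a ![w']) c w - fderiv ℝ (fun a => β a ![w]) c w' := by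
  rw [extDeriv_apply h, Fin.sum_univ_two]
  have h0 : Fin.removeNth 0 ![w, w'] = ![w'] := by ext i; fin_cases i; rfl
  have h1 : Fin.removeNth 1 ![w, w'] = ![w] := by ext i; fin_cases i; rfl
  rw [h0, h1]
  simp [sub_eq_add_neg]

end

/-! ### The exterior derivative of `Θ` over the identity. -/

section Formula

variable {E : Type*} [NormedAddCommGroup E] [NormedSpace ℝ E]
  {X : Type*} [TopologicalSpace X] {I : ModelWithCorners ℝ E X}
  {H : Type*} [TopologicalSpace H] [ChartedSpace X H] [Group H] [LieGroup I ∞ H]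
  {F : Type*} [NormedAddCommGroup F] [NormedSpace ℝ F]
  {Y : Type*} [TopologicalSpace Y] {J : ModelWithCorners ℝ F Y}
  {P : Type*} [TopologicalSpace P] [ChartedSpace Y P]

variable (I J) in
/-- The derivative of `φ` at `(e, x)`. -/
def dPotential (φ : H × P → LieDual I H) (x : P) : E × F →L[ℝ] (E →L[ℝ] ℝ) :=
  mfderiv (I.prod J) 𝓘(ℝ, E →L[ℝ] ℝ) φ ((1 : H), x)

lemma hasMFDerivAt_potential {φ : H × P → LieDual I H}
    (hφ : ContMDiff (I.prod J) 𝓘(ℝ, E →L[ℝ] ℝ) ∞ φ) (x : P) :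
    HasMFDerivAt (I.prod J) 𝓘(ℝ, E →L[ℝ] ℝ) φ ((1 : H), x) (dPotential I J φ x) :=
  (hφ.contMDiffAt.mdifferentiableAt infty_ne_zero).hasMFDerivAt

lemma mvfderiv_potential {φ : H × P → LieDual I H}
    (hφ : ContMDiff (I.prod J) 𝓘(ℝ, E →L[ℝ] ℝ) ∞ φ) (x : P) (ξ : E) (w : E × F) :
    mvfderiv (I.prod J) (fun y : H × P => φ y ξ) ((1 : H), x) w = dPotential I J φ x w ξ :=
  mvfderiv_apply_of_hasMFDerivAt (A := (ContinuousLinearMap.apply ℝ ℝ ξ).comp (dPotential I J φ x))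
    (HasMFDerivAt.comp ((1 : H), x) (ContinuousLinearMap.hasMFDerivAt _)
      (hasMFDerivAt_potential hφ x)) w

variable [I.Boundaryless] [FiniteDimensional ℝ E] [J.Boundaryless] [FiniteDimensional ℝ F]
  [IsManifold J ∞ P] [MulAction H P] [ContMDiffSMul I J ∞ H P]

lemma extChartAt_body_symm_apply (ν : LieDual I H) (x : P) (b : E × ((E →L[ℝ] ℝ) × F)) :
    (extChartAt (bodyModel I J) ((1 : H), (ν, x))).symm b
      = ((extChartAt I (1 : H)).symm b.1, b.2.1, (extChartAt J x).symm b.2.2) := by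
  simp only [extChartAt_prod]
  rfl

lemma chartRep_bodyOneForm {φ : H × P → LieDual I H}
    (hφ : ContMDiff (I.prod J) 𝓘(ℝ, E →L[ℝ] ℝ) ∞ φ) (ν : LieDual I H) (x : P)
    {a : E × ((E →L[ℝ] ℝ) × F)}
    (ha : a ∈ (extChartAt (bodyModel I J) ((1 : H), (ν, x))).target)
    (v : Fin 1 → E × ((E →L[ℝ] ℝ) × F)) :
    chartRep (bodyModel I J) (bodyOneForm I J φ) ((1 : H), (ν, x)) a v
      = (a.2.1 + φ (1, (extChartAt J x).symm a.2.2)) (mcChart I H a.1 (v 0).1) := by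
  have ha1 : a.1 ∈ (extChartAt I (1 : H)).target := by
    rw [extChartAt_prod] at ha
    exact ha.1
  have hχ : MDifferentiableAt 𝓘(ℝ, E × ((E →L[ℝ] ℝ) × F)) (bodyModel I J)
      (extChartAt (bodyModel I J) ((1 : H), (ν, x))).symm a :=
    (contMDiffAt_extChartAt_symm ha).mdifferentiableAt infty_ne_zero
  have hm := (contMDiff_momentumMap hφ).contMDiffAt.mdifferentiableAt infty_ne_zero
    (x := (extChartAt (bodyModel I J) ((1 : H), (ν, x))).symm a)
  have h1 : chartRep (bodyModel I J) (bodyOneForm I J φ) ((1 : H), (ν, x)) a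
      = pullback 𝓘(ℝ, E × ((E →L[ℝ] ℝ) × F)) (cotangentModel I)
        (momentumMap I φ ∘ (extChartAt (bodyModel I J) ((1 : H), (ν, x))).symm)
        (canonicalOneForm I H) a := (pullback_comp hm hχ).symm
  have h2 := pullback_canonicalOneForm (hm.comp a hχ) v
  rw [h1]
  refine h2.trans ?_
  have h3 : (mfderiv 𝓘(ℝ, E × ((E →L[ℝ] ℝ) × F)) I (fun b => ((momentumMap I φ ∘
      (extChartAt (bodyModel I J) ((1 : H), (ν, x))).symm) b).proj) a :
      E × ((E →L[ℝ] ℝ) × F) →L[ℝ] E) =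
      (mfderiv 𝓘(ℝ, E) I (extChartAt I (1 : H)).symm a.1 : E →L[ℝ] E).comp
        (ContinuousLinearMap.fst ℝ E ((E →L[ℝ] ℝ) × F)) := by
    have e : (fun b => ((momentumMap I φ ∘
        (extChartAt (bodyModel I J) ((1 : H), (ν, x))).symm) b).proj)
        = fun b : E × ((E →L[ℝ] ℝ) × F) => (extChartAt I (1 : H)).symm b.1 := by
      funext b
      exact congrArg Prod.fst (extChartAt_body_symm_apply ν x b)
    rw [e]
    exact HasMFDerivAt.mfderiv (HasMFDerivAt.comp a (I' := 𝓘(ℝ, E))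
      ((contMDiffAt_extChartAt_symm ha1).mdifferentiableAt infty_ne_zero).hasMFDerivAt
      (hasFDerivAt_fst.hasMFDerivAt))
  have h4 : ∀ u : E, (((momentumMap I φ ∘
      (extChartAt (bodyModel I J) ((1 : H), (ν, x))).symm) a).snd : E →L[ℝ] ℝ) u
      = (a.2.1 + φ (1, (extChartAt J x).symm a.2.2))
        ((leftTangentInv I ((extChartAt I (1 : H)).symm a.1) : E →L[ℝ] E) u) := by
    intro u
    have e := extChartAt_body_symm_apply (I := I) (J := J) (H := H) ν x a
    exact congrArg (fun z : H × (LieDual I H × P) => (z.2.1 + φ (1, z.2.2))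
      ((leftTangentInv I z.1 : E →L[ℝ] E) u)) e
  refine (congrArg _ (DFunLike.congr_fun h3 (v 0))).trans ?_
  exact h4 _

/-- The shift uses `φ` at the fixed group element `e`, so only the derivative of `φ` along `P`
appears. -/
lemma hasFDerivAt_shift {φ : H × P → LieDual I H}
    (hφ : ContMDiff (I.prod J) 𝓘(ℝ, E →L[ℝ] ℝ) ∞ φ) (ν : LieDual I H) (x : P) :
    HasFDerivAt (fun a : E × ((E →L[ℝ] ℝ) × F) =>
        (a.2.1 + φ (1, (extChartAt J x).symm a.2.2) : E →L[ℝ] ℝ))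
      ((ContinuousLinearMap.fst ℝ (E →L[ℝ] ℝ) F + (dPotential I J φ x).comp
        ((ContinuousLinearMap.inr ℝ E F).comp (ContinuousLinearMap.snd ℝ (E →L[ℝ] ℝ) F))).comp
          (ContinuousLinearMap.snd ℝ E ((E →L[ℝ] ℝ) × F)))
      (chartOne I H, (ν, extChartAt J x x)) := by
  have hs : HasMFDerivAt 𝓘(ℝ, F) J (extChartAt J x).symm (extChartAt J x x)
      (ContinuousLinearMap.id ℝ F) := by
    have := ((contMDiffAt_extChartAt_symm (I := J)
      (mem_extChartAt_target x)).mdifferentiableAt infty_ne_zero).hasMFDerivAt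
    exact mfderiv_extChartAt_symm_self (I := J) x ▸ this
  have h1 : HasMFDerivAt 𝓘(ℝ, F) (I.prod J) (fun b => ((1 : H), (extChartAt J x).symm b))
      (extChartAt J x x) (ContinuousLinearMap.inr ℝ E F) :=
    (hasMFDerivAt_const (1 : H) (extChartAt J x x)).prodMk hs
  have h2 : HasMFDerivAt (I.prod J) 𝓘(ℝ, E →L[ℝ] ℝ) φ
      ((1 : H), (extChartAt J x).symm (extChartAt J x x)) (dPotential I J φ x) := by
    rw [extChartAt_to_inv]
    exact hasMFDerivAt_potential hφ x
  have h3 : HasMFDerivAt 𝓘(ℝ, F) 𝓘(ℝ, E →L[ℝ] ℝ) (fun b => φ (1, (extChartAt J x).symm b))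
      (extChartAt J x x) ((dPotential I J φ x).comp (ContinuousLinearMap.inr ℝ E F)) :=
    HasMFDerivAt.comp (extChartAt J x x) h2 h1
  have h4 : HasFDerivAt (fun b => φ (1, (extChartAt J x).symm b))
      ((dPotential I J φ x).comp (ContinuousLinearMap.inr ℝ E F)) (extChartAt J x x) :=
    h3.hasFDerivAt
  have h5 : HasFDerivAt (fun a : E × ((E →L[ℝ] ℝ) × F) => a.2.2)
      ((ContinuousLinearMap.snd ℝ (E →L[ℝ] ℝ) F).comp
        (ContinuousLinearMap.snd ℝ E ((E →L[ℝ] ℝ) × F)))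
      (chartOne I H, (ν, extChartAt J x x)) :=
    ((ContinuousLinearMap.snd ℝ (E →L[ℝ] ℝ) F).comp
      (ContinuousLinearMap.snd ℝ E ((E →L[ℝ] ℝ) × F))).hasFDerivAt
  have h6 : HasFDerivAt (fun a : E × ((E →L[ℝ] ℝ) × F) => a.2.1)
      ((ContinuousLinearMap.fst ℝ (E →L[ℝ] ℝ) F).comp
        (ContinuousLinearMap.snd ℝ E ((E →L[ℝ] ℝ) × F)))
      (chartOne I H, (ν, extChartAt J x x)) :=
    ((ContinuousLinearMap.fst ℝ (E →L[ℝ] ℝ) F).comp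
      (ContinuousLinearMap.snd ℝ E ((E →L[ℝ] ℝ) × F))).hasFDerivAt
  exact h6.add (HasFDerivAt.comp (chartOne I H, (ν, extChartAt J x x)) h4 h5)

/-- In the chart `Θ` is the moving covector `μ + φ(e, x)` applied to `mcChart`. Differentiating the
covector gives the first two terms; antisymmetrizing the derivative of `mcChart` gives the bracket,
which is the Maurer-Cartan equation. -/
theorem extD_bodyOneForm {φ : H × P → LieDual I H}
    (hφ : ContMDiff (I.prod J) 𝓘(ℝ, E →L[ℝ] ℝ) ∞ φ) (ν : LieDual I H) (x : P)
    (w w' : E × ((E →L[ℝ] ℝ) × F)) :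
    extD (bodyModel I J) (bodyOneForm I J φ) ((1 : H), (ν, x)) ![w, w']
      = (w.2.1 + dPotential I J φ x (0, w.2.2)) w'.1
        - (w'.2.1 + dPotential I J φ x (0, w'.2.2)) w.1
        - (ν + φ (1, x)) (⁅(show GroupLieAlgebra I H from w.1), (show GroupLieAlgebra I H from w'.1)⁆ :
            GroupLieAlgebra I H) := by
  let c : E × ((E →L[ℝ] ℝ) × F) := (chartOne I H, (ν, extChartAt J x x))
  have hc : extChartAt (bodyModel I J) ((1 : H), (ν, x)) ((1 : H), (ν, x)) = c := by
    simp only [extChartAt_prod]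
    rfl
  have hβ : ContDiffAt ℝ ∞ (chartRep (bodyModel I J) (bodyOneForm I J φ) ((1 : H), (ν, x))) c := by
    rw [← hc]
    exact smoothFormAt_bodyOneForm hφ _
  have key : ∀ u u' : E × ((E →L[ℝ] ℝ) × F), fderiv ℝ (fun a =>
      chartRep (bodyModel I J) (bodyOneForm I J φ) ((1 : H), (ν, x)) a ![u']) c u
      = (u.2.1 + dPotential I J φ x (0, u.2.2)) u'.1
        - (ν + φ (1, x)) (fderiv ℝ (leftFactor I H) (chartOne I H) u.1 u'.1) := by
    intro u u'
    have h1 : (fun a => chartRep (bodyModel I J) (bodyOneForm I J φ) ((1 : H), (ν, x)) a ![u'])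
        =ᶠ[𝓝 c] fun a => (a.2.1 + φ (1, (extChartAt J x).symm a.2.2) : E →L[ℝ] ℝ)
          (mcChart I H a.1 u'.1) := by
      rw [← hc]
      filter_upwards [extChartAt_target_mem_nhds (I := bodyModel I J) ((1 : H), (ν, x))] with a ha
      exact chartRep_bodyOneForm hφ ν x ha ![u']
    have h2 := (((contDiffAt_mcChart I (H := H)).differentiableAt infty_ne_zero).hasFDerivAt.comp
      c (f := fun a : E × ((E →L[ℝ] ℝ) × F) => a.1) hasFDerivAt_fst).clm_apply
      (hasFDerivAt_const u'.1 c)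
    have h3 := (hasFDerivAt_shift hφ ν x).clm_apply h2
    rw [h1.fderiv_eq]
    refine (DFunLike.congr_fun h3.fderiv u).trans ?_
    have e2 := mcChart_one I (H := H)
    simp [c, e2, fderiv_mcChart_apply]
    ring
  rw [extD_eq, hc]
  refine (extDeriv_one_apply (hβ.differentiableAt infty_ne_zero) w w').trans ?_
  rw [key, key]
  have hbr := bracket_eq_fderiv_leftFactor I (H := H) w.1 w'.1
  have hbr' := (congrArg (ν + φ (1, x) : E →L[ℝ] ℝ) hbr).trans
    (map_sub (ν + φ (1, x) : E →L[ℝ] ℝ) _ _)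
  refine Eq.trans ?_ (congrArg (fun t => (w.2.1 + dPotential I J φ x (0, w.2.2)) w'.1
        - (w'.2.1 + dPotential I J φ x (0, w'.2.2)) w.1 - t) hbr').symm
  ring

end Formula

/-! ### Algebra of two-forms on a vector space. -/

section

variable {V : Type*} [NormedAddCommGroup V] [NormedSpace ℝ V]

lemma alternating_add_left (b : V [⋀^Fin 2]→L[ℝ] ℝ) (v v' w : V) :
    b ![v + v', w] = b ![v, w] + b ![v', w] := by
  have h := b.map_update_add ![v, w] 0 v v'
  rwa [update_zero, update_zero, update_zero] at h

lemma alternating_swap (b : V [⋀^Fin 2]→L[ℝ] ℝ) (v w : V) : b ![v, w] = -b ![w, v] := by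
  have h := b.map_swap ![w, v] (i := 0) (j := 1) (by decide)
  have e : ![w, v] ∘ Equiv.swap (0 : Fin 2) 1 = ![v, w] := by
    ext i
    fin_cases i <;> rfl
  rw [e] at h
  exact h

lemma alternating_add_right (b : V [⋀^Fin 2]→L[ℝ] ℝ) (v w w' : V) :
    b ![v, w + w'] = b ![v, w] + b ![v, w'] := by
  have h := b.map_update_add ![v, w] 1 w w'
  rwa [update_one, update_one, update_one] at h

lemma alternating_expand {b : V [⋀^Fin 2]→L[ℝ] ℝ} {v u v' u' : V} {r₁ r₂ r₃ r₄ : ℝ}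
    (h₁ : b ![v, v'] = r₁) (h₂ : b ![v, u'] = r₂) (h₃ : b ![v', u] = r₃) (h₄ : b ![u, u'] = -r₄) :
    b ![v + u, v' + u'] = r₁ + r₂ - r₃ - r₄ := by
  rw [← h₁, ← h₂, ← h₃, ← neg_neg r₄, ← h₄, alternating_add_left, alternating_add_right, alternating_add_right, alternating_swap b u v']
  ring

lemma eq_zero_of_forall_dual [FiniteDimensional ℝ V] {v : V} (h : ∀ ρ : V →L[ℝ] ℝ, ρ v = 0) :
    v = 0 := by
  by_contra hv
  obtain ⟨g, -, hg⟩ := exists_dual_vector ℝ v (norm_ne_zero_iff.2 hv)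
  rw [h] at hg
  exact hv (norm_eq_zero.1 (by exact_mod_cast hg.symm))

end

/-! ### Orbit directions, the two-cocycle, and the shifted form over the identity. -/

section Formula

variable {E : Type*} [NormedAddCommGroup E] [NormedSpace ℝ E]
  {X : Type*} [TopologicalSpace X] {I : ModelWithCorners ℝ E X}
  {H : Type*} [TopologicalSpace H] [ChartedSpace X H] [Group H] [LieGroup I ∞ H]
  {F : Type*} [NormedAddCommGroup F] [NormedSpace ℝ F]
  {Y : Type*} [TopologicalSpace Y] {J : ModelWithCorners ℝ F Y}
  {P : Type*} [TopologicalSpace P] [ChartedSpace Y P]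
  [IsManifold J ∞ P] [MulAction H P] [ContMDiffSMul I J ∞ H P]

variable (I J) (H) in
/-- The derivative at the identity of the orbit map `h ↦ (h, h · x)`. -/
def orbitDeriv (x : P) : E →L[ℝ] E × F :=
  mfderiv I (I.prod J) (fun h : H => (diagAct h ((1 : H), x) : H × P)) (1 : H)

lemma hasMFDerivAt_orbit (x : P) :
    HasMFDerivAt I (I.prod J) (fun h : H => (diagAct h ((1 : H), x) : H × P)) (1 : H)
      (orbitDeriv I H J x) := by
  have h : ContMDiff I (I.prod J) ∞ (fun h : H => (diagAct h ((1 : H), x) : H × P)) :=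
    (contMDiff_mul_right (I := I) (n := ∞)).prodMk
      ((contMDiff_smul (I := I) (I' := J)).comp (contMDiff_id.prodMk contMDiff_const))
  exact (h.contMDiffAt.mdifferentiableAt infty_ne_zero).hasMFDerivAt

/-- The partial derivative along `H` is the orbit direction; the one along `P` is the identity,
because `e` acts trivially. This splitting matches what is known about `B`. -/
lemma mfderiv_spatialMap (ν : LieDual I H) (x : P) :
    ∃ A : E × ((E →L[ℝ] ℝ) × F) →L[ℝ] E × F,
      (mfderiv (bodyModel I J) (I.prod J) (spatialMap : H × ((E →L[ℝ] ℝ) × P) → H × P)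
        ((1 : H), (ν, x)) = A) ∧
      ∀ w, A w = orbitDeriv I H J x w.1 + (0, w.2.2) := by
  have hs : MDifferentiableAt (I.prod J) J (fun p : H × P => p.1 • p.2) ((1 : H), x) :=
    (contMDiff_smul (I := I) (I' := J) (n := ∞)).contMDiffAt.mdifferentiableAt infty_ne_zero
  let S : E × F →L[ℝ] F := mfderiv (I.prod J) J (fun p : H × P => p.1 • p.2) ((1 : H), x)
  have hS : HasMFDerivAt (I.prod J) J (fun p : H × P => p.1 • p.2) ((1 : H), x) S :=
    hs.hasMFDerivAt
  have h1 : HasMFDerivAt (bodyModel I J) J (fun z : H × ((E →L[ℝ] ℝ) × P) => z.1 • z.2.2)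
      ((1 : H), (ν, x)) (S.comp ((ContinuousLinearMap.fst ℝ E ((E →L[ℝ] ℝ) × F)).prod
        ((ContinuousLinearMap.snd ℝ (E →L[ℝ] ℝ) F).comp
          (ContinuousLinearMap.snd ℝ E ((E →L[ℝ] ℝ) × F))))) :=
    HasMFDerivAt.comp (f := fun z : H × ((E →L[ℝ] ℝ) × P) => (z.1, z.2.2))
      ((1 : H), ((ν : E →L[ℝ] ℝ), x)) hS
      ((hasMFDerivAt_fst _).prodMk ((hasMFDerivAt_snd _).comp _ (hasMFDerivAt_snd _)))
  have h2 : HasMFDerivAt I (I.prod J) (fun h : H => (diagAct h ((1 : H), x) : H × P)) (1 : H)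
      ((ContinuousLinearMap.id ℝ E).prod
        (S.comp ((ContinuousLinearMap.id ℝ E).prod (0 : E →L[ℝ] F)))) := by
    have h3 : HasMFDerivAt I J (fun h : H => h • x) (1 : H)
        (S.comp ((ContinuousLinearMap.id ℝ E).prod (0 : E →L[ℝ] F))) :=
      HasMFDerivAt.comp (f := fun h : H => (h, x)) (1 : H) hS
        ((hasMFDerivAt_id _).prodMk (hasMFDerivAt_const x _))
    have h4 : HasMFDerivAt I I (fun h : H => h * 1) (1 : H) (ContinuousLinearMap.id ℝ E) := by
      exact (hasMFDerivAt_id (1 : H)).congr_of_eventuallyEq (Eventually.of_forall mul_one)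
    exact h4.prodMk h3
  have h5 : HasMFDerivAt J J (fun y : P => (1 : H) • y) x
      (S.comp ((0 : F →L[ℝ] E).prod (ContinuousLinearMap.id ℝ F))) :=
    HasMFDerivAt.comp (f := fun y : P => ((1 : H), y)) x hS
      ((hasMFDerivAt_const (1 : H) x).prodMk (hasMFDerivAt_id x))
  have h6 : S.comp ((0 : F →L[ℝ] E).prod (ContinuousLinearMap.id ℝ F))
      = ContinuousLinearMap.id ℝ F := by
    have h := (hasMFDerivAt_id x).congr_of_eventuallyEq (I' := J)
      (Eventually.of_forall (one_smul H : ∀ y : P, (1 : H) • y = y))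
    exact hasMFDerivAt_unique h5 h
  have h7 : orbitDeriv I H J x = (ContinuousLinearMap.id ℝ E).prod
      (S.comp ((ContinuousLinearMap.id ℝ E).prod (0 : E →L[ℝ] F))) := h2.mfderiv
  refine ⟨_, ((hasMFDerivAt_fst _).prodMk h1).mfderiv, fun w => ?_⟩
  have h8 : S (0, w.2.2) = w.2.2 := DFunLike.congr_fun h6 w.2.2
  have h9 : S (w.1, w.2.2) = S (w.1, 0) + S (0, w.2.2) := by
    rw [← map_add]; simp
  rw [h7]
  refine Prod.ext (add_zero _).symm ?_
  exact h9.trans (congrArg (fun t => S (w.1, 0) + t) h8)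

variable {B : DiffForm (I.prod J) (H × P) 2} {φ : H × P → LieDual I H}

lemma potential_apply (hφ : IsBgPotential I J B φ) (x : P) (ξ : E) (w : E × F) :
    (B ((1 : H), x) : (E × F) [⋀^Fin 2]→L[ℝ] ℝ) ![orbitDeriv I H J x ξ, w]
      = dPotential I J φ x w ξ :=
  (hφ.potential ξ ((1 : H), x) w).trans (mvfderiv_potential hφ.smooth x ξ w)

lemma restrict_apply {ωP : DiffForm J P 2} (hB : ∀ (g : H) (x : P),
      pullback J (I.prod J) (fun y : P => (g, y)) B x = -ωP x) (x : P) (u u' : F) :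
    (B ((1 : H), x) : (E × F) [⋀^Fin 2]→L[ℝ] ℝ) ![(0, u), (0, u')]
      = -(ωP x : F [⋀^Fin 2]→L[ℝ] ℝ) ![u, u'] := by
  have h1 := DFunLike.congr_fun (hB 1 x) (![u, u'] : Fin 2 → F)
  have h2 : HasMFDerivAt J (I.prod J) (fun y : P => ((1 : H), y)) x
      ((0 : F →L[ℝ] E).prod (ContinuousLinearMap.id ℝ F)) :=
    (hasMFDerivAt_const (1 : H) x).prodMk (hasMFDerivAt_id x)
  have h3 := pullback_apply_of_eq (Ω := B) (f := fun y : P => ((1 : H), y)) rfl h2.mfderiv ![u, u']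
  have h4 : (fun i => ((0 : F →L[ℝ] E).prod (ContinuousLinearMap.id ℝ F)) ((![u, u'] : Fin 2 → F) i))
      = ![((0 : E), u), (0, u')] := by
    ext i <;> fin_cases i <;> rfl
  rw [h4] at h3
  exact h3.symm.trans h1

lemma pullback_spatialMap_apply (hφ : IsBgPotential I J B φ) {ωP : DiffForm J P 2}
    (hB : ∀ (g : H) (x : P), pullback J (I.prod J) (fun y : P => (g, y)) B x = -ωP x)
    (ν : LieDual I H) (x : P) (w w' : E × ((E →L[ℝ] ℝ) × F)) :
    (pullback (bodyModel I J) (I.prod J) spatialMap B ((1 : H), (ν, x)) :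
        (E × ((E →L[ℝ] ℝ) × F)) [⋀^Fin 2]→L[ℝ] ℝ) ![w, w']
      = dPotential I J φ x (orbitDeriv I H J x w'.1) w.1 + dPotential I J φ x (0, w'.2.2) w.1
        - dPotential I J φ x (0, w.2.2) w'.1
        - (ωP x : F [⋀^Fin 2]→L[ℝ] ℝ) ![w.2.2, w'.2.2] := by
  obtain ⟨A, hA, hA'⟩ := mfderiv_spatialMap (I := I) (J := J) (H := H) ν x
  have h1 := pullback_apply_of_eq (Ω := B) (y := ((1 : H), x))
    (f := (spatialMap : H × ((E →L[ℝ] ℝ) × P) → H × P)) (x := ((1 : H), (ν, x)))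
    (Prod.ext rfl (one_smul H x)) hA ![w, w']
  have h2 : (fun i => A ((![w, w'] : Fin 2 → E × ((E →L[ℝ] ℝ) × F)) i))
      = ![orbitDeriv I H J x w.1 + (0, w.2.2), orbitDeriv I H J x w'.1 + (0, w'.2.2)] := by
    funext i
    fin_cases i <;> exact hA' _
  rw [h2] at h1
  exact h1.trans (alternating_expand (V := E × F) (potential_apply hφ x w.1 (orbitDeriv I H J x w'.1))
    (potential_apply hφ x w.1 (0, w'.2.2)) (potential_apply hφ x w'.1 (0, w.2.2))
    (restrict_apply hB x w.2.2 w'.2.2))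

/-- Both sides are values of `B` on a pair of fundamental vectors, taken in opposite orders. -/
lemma dPotential_orbit_antisymm (hφ : IsBgPotential I J B φ) (x : P) (ξ η : E) :
    dPotential I J φ x (orbitDeriv I H J x ξ) η = -dPotential I J φ x (orbitDeriv I H J x η) ξ := by
  have e := alternating_swap (B ((1 : H), x) : (E × F) [⋀^Fin 2]→L[ℝ] ℝ)
    (orbitDeriv I H J x η) (orbitDeriv I H J x ξ)
  exact (potential_apply hφ x η (orbitDeriv I H J x ξ)).symm.trans
    (e.trans (congrArg Neg.neg (potential_apply hφ x ξ (orbitDeriv I H J x η))))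

variable [I.Boundaryless] [FiniteDimensional ℝ E]

/-- The first part of the cocycle is differentiated along the orbit; in the second `φ(e, x)` is
constant and `Ad_{g⁻¹} η` has derivative `-[ξ, η]`. -/
lemma twoCocycle_apply (hφ : ContMDiff (I.prod J) 𝓘(ℝ, E →L[ℝ] ℝ) ∞ φ) (x : P)
    (ξ η : GroupLieAlgebra I H) :
    twoCocycle I φ ξ η ((1 : H), x)
      = -dPotential I J φ x (orbitDeriv I H J x ξ) η - φ (1, x) (⁅ξ, η⁆ : GroupLieAlgebra I H) := by
  obtain ⟨A, hA, hA'⟩ := hasMFDerivAt_adInv I (H := H) η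
  have h1 : HasMFDerivAt (I.prod J) 𝓘(ℝ, E →L[ℝ] ℝ) φ (diagAct (1 : H) ((1 : H), x))
      (dPotential I J φ x) := by
    have e : diagAct (1 : H) ((1 : H), x) = ((1 : H), x) :=
      Prod.ext (one_mul _) (one_smul _ _)
    rw [e]
    exact hasMFDerivAt_potential hφ x
  have h2 := HasMFDerivAt.comp (f := fun h : H => (diagAct h ((1 : H), x) : H × P)) (1 : H) h1
    (hasMFDerivAt_orbit x)
  have h3 : HasMFDerivAt I 𝓘(ℝ, ℝ) (fun g : H => φ (diagAct g ((1 : H), x)) η) (1 : H)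
      ((ContinuousLinearMap.apply ℝ ℝ (show E from η)).comp
        ((dPotential I J φ x).comp (orbitDeriv I H J x))) :=
    HasMFDerivAt.comp (f := fun h : H => φ (diagAct h ((1 : H), x))) (1 : H)
      (ContinuousLinearMap.apply ℝ ℝ (show E from η)).hasMFDerivAt h2
  have h4 : HasMFDerivAt I 𝓘(ℝ, ℝ) (fun g : H => φ (1, x) (adInv I η g)) (1 : H)
      ((φ (1, x) : E →L[ℝ] ℝ).comp A) :=
    HasMFDerivAt.comp (f := adInv I (H := H) η) (1 : H) (φ (1, x) : E →L[ℝ] ℝ).hasMFDerivAt hA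
  have h5 := mvfderiv_apply_of_hasMFDerivAt (h3.neg.add h4) ξ
  refine Eq.trans h5 ?_
  have h6 : (φ (1, x) : E →L[ℝ] ℝ) (A ξ) = -φ (1, x) (⁅ξ, η⁆ : GroupLieAlgebra I H) :=
    (congrArg (φ (1, x)) (hA' ξ)).trans (map_neg (φ (1, x)) _)
  exact (congrArg (fun t => -dPotential I J φ x (orbitDeriv I H J x ξ) η + t) h6).trans
    (sub_eq_add_neg _ _).symm

variable [J.Boundaryless] [FiniteDimensional ℝ F]

/-- The derivatives of `φ` along `P` in `-dΘ` and `-s^*B` cancel. The orbit derivative, rewritten by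
antisymmetry, and `φ(e, x)` on the bracket are together `-Σ`. -/
theorem shiftedForm_one_apply (hφ : IsBgPotential I J B φ) {ωP : DiffForm J P 2}
    (hB : ∀ (g : H) (x : P), pullback J (I.prod J) (fun y : P => (g, y)) B x = -ωP x)
    (ν : LieDual I H) (x : P) (w w' : E × ((E →L[ℝ] ℝ) × F)) :
    (shiftedForm I J B φ ((1 : H), (ν, x)) : (E × ((E →L[ℝ] ℝ) × F)) [⋀^Fin 2]→L[ℝ] ℝ) ![w, w']
      = w'.2.1 w.1 - w.2.1 w'.1
        + ν (⁅(show GroupLieAlgebra I H from w.1), (show GroupLieAlgebra I H from w'.1)⁆ :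
            GroupLieAlgebra I H)
        - twoCocycle I φ (w.1 : E) (w'.1 : E) ((1 : H), x)
        + (ωP x : F [⋀^Fin 2]→L[ℝ] ℝ) ![w.2.2, w'.2.2] := by
  have h1 := DFunLike.congr_fun (congrFun (shiftedForm_eq (B := B) hφ.smooth) ((1 : H), (ν, x)))
    (![w, w'] : Fin 2 → E × ((E →L[ℝ] ℝ) × F))
  refine h1.trans ?_
  have h2 := extD_bodyOneForm hφ.smooth ν x w w'
  have h3 := pullback_spatialMap_apply hφ hB ν x w w'
  have h4 := twoCocycle_apply hφ.smooth x (w.1 : E) (w'.1 : E)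
  have h5 := dPotential_orbit_antisymm hφ x w.1 w'.1
  refine (congrArg₂ (fun s t : ℝ => -s - t) h2 h3).trans ?_
  rw [h4, h5]
  set br : E := (⁅(show GroupLieAlgebra I H from w.1), (show GroupLieAlgebra I H from w'.1)⁆ :
            GroupLieAlgebra I H)
  simp only [add_apply]
  ring

end Formula

/-! ### Nondegeneracy and the induced bracket. -/

section

variable {V : Type*} [NormedAddCommGroup V] [NormedSpace ℝ V]

lemma alternating_zero_right (b : V [⋀^Fin 2]→L[ℝ] ℝ) (v : V) : b ![v, 0] = 0 :=
  b.map_coord_zero (m := ![v, 0]) 1 rfl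

end

section Bracket

variable {E : Type*} [NormedAddCommGroup E] [NormedSpace ℝ E]
  {X : Type*} [TopologicalSpace X] {I : ModelWithCorners ℝ E X}
  {H : Type*} [TopologicalSpace H] [ChartedSpace X H] [Group H] [LieGroup I ∞ H]
  {F : Type*} [NormedAddCommGroup F] [NormedSpace ℝ F]
  {Y : Type*} [TopologicalSpace Y] {J : ModelWithCorners ℝ F Y}
  {P : Type*} [TopologicalSpace P] [ChartedSpace Y P]
  [IsManifold J ∞ P] [MulAction H P] [ContMDiffSMul I J ∞ H P]

lemma mvfderiv_comp_snd {f : LieDual I H × P → ℝ}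
    (hf : ContMDiff (𝓘(ℝ, E →L[ℝ] ℝ).prod J) 𝓘(ℝ, ℝ) ∞ f) (g : H) (ν : LieDual I H) (x : P)
    (w : E × ((E →L[ℝ] ℝ) × F)) :
    mvfderiv (bodyModel I J) (f ∘ (Prod.snd : H × (LieDual I H × P) → LieDual I H × P))
        (g, (ν, x)) w
      = fderiv ℝ (fun μ => f (μ, x)) ν w.2.1 + mvfderiv J (fun y => f (ν, y)) x w.2.2 := by
  let A : (E →L[ℝ] ℝ) × F →L[ℝ] ℝ := mfderiv (𝓘(ℝ, E →L[ℝ] ℝ).prod J) 𝓘(ℝ, ℝ) f (ν, x)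
  have hA : HasMFDerivAt (𝓘(ℝ, E →L[ℝ] ℝ).prod J) 𝓘(ℝ, ℝ) f (ν, x) A :=
    (hf.contMDiffAt.mdifferentiableAt infty_ne_zero).hasMFDerivAt
  have h1 : HasMFDerivAt (bodyModel I J) 𝓘(ℝ, ℝ)
      (f ∘ (Prod.snd : H × (LieDual I H × P) → LieDual I H × P)) (g, (ν, x))
      (A.comp (ContinuousLinearMap.snd ℝ E ((E →L[ℝ] ℝ) × F))) :=
    HasMFDerivAt.comp (g, (ν, x)) hA (hasMFDerivAt_snd _)
  have h2 : HasMFDerivAt 𝓘(ℝ, E →L[ℝ] ℝ) 𝓘(ℝ, ℝ) (fun μ => f (μ, x)) ν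
      (A.comp (ContinuousLinearMap.inl ℝ (E →L[ℝ] ℝ) F)) :=
    HasMFDerivAt.comp (f := fun μ => (μ, x)) ν hA
      ((hasMFDerivAt_id ν).prodMk (hasMFDerivAt_const x ν))
  have h3 : HasMFDerivAt J 𝓘(ℝ, ℝ) (fun y => f (ν, y)) x
      (A.comp (ContinuousLinearMap.inr ℝ (E →L[ℝ] ℝ) F)) :=
    HasMFDerivAt.comp (f := fun y => (ν, y)) x hA
      ((hasMFDerivAt_const ν x).prodMk (hasMFDerivAt_id x))
  have h2' : HasFDerivAt (fun μ => f (μ, x)) (A.comp (ContinuousLinearMap.inl ℝ (E →L[ℝ] ℝ) F)) ν :=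
    h2.hasFDerivAt
  have e1 := mvfderiv_apply_of_hasMFDerivAt h1 w
  have e2 := DFunLike.congr_fun h2'.fderiv w.2.1
  have e3 := mvfderiv_apply_of_hasMFDerivAt h3 w.2.2
  have e4 : A w.2 = A (w.2.1, 0) + A (0, w.2.2) := by
    rw [← map_add]; simp
  exact e1.trans (e4.trans (congrArg₂ (· + ·) e2.symm e3.symm))

variable [I.Boundaryless] [FiniteDimensional ℝ E]

lemma apply_bracket_zero_left (ν : LieDual I H) (ξ : GroupLieAlgebra I H) :
    ν (⁅(0 : GroupLieAlgebra I H), ξ⁆ : GroupLieAlgebra I H) = 0 := by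
  have e (ζ : E) : fderiv ℝ (leftFactor I H) (chartOne I H) 0 ζ
      - fderiv ℝ (leftFactor I H) (chartOne I H) ζ 0 = 0 := by simp
  exact (congrArg ν ((bracket_eq_fderiv_leftFactor I (H := H) 0 ξ).trans (e ξ))).trans (map_zero ν)

/-- Immediate from the chart formula for the bracket, an antisymmetrized second derivative. -/
lemma apply_bracket_skew (ν : LieDual I H) (ξ η : GroupLieAlgebra I H) :
    ν (⁅ξ, η⁆ : GroupLieAlgebra I H) = -ν (⁅η, ξ⁆ : GroupLieAlgebra I H) := by
  have h1 := congrArg ν (bracket_eq_fderiv_leftFactor I (H := H) ξ η)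
  have h2 := congrArg ν (bracket_eq_fderiv_leftFactor I (H := H) η ξ)
  refine h1.trans (Eq.trans ?_ (congrArg Neg.neg h2.symm))
  rw [← map_neg, neg_sub]

lemma apply_bracket_zero_right (ν : LieDual I H) (ξ : GroupLieAlgebra I H) :
    ν (⁅ξ, (0 : GroupLieAlgebra I H)⁆ : GroupLieAlgebra I H) = 0 := by
  rw [apply_bracket_skew, apply_bracket_zero_left, neg_zero]

variable {B : DiffForm (I.prod J) (H × P) 2} {φ : H × P → LieDual I H}

lemma twoCocycle_antisymm (hφ : IsBgPotential I J B φ) (x : P) (ξ η : GroupLieAlgebra I H) :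
    twoCocycle I φ ξ η ((1 : H), x) = -twoCocycle I φ η ξ ((1 : H), x) := by
  rw [twoCocycle_apply hφ.smooth, twoCocycle_apply hφ.smooth, apply_bracket_skew (φ (1, x)) ξ η,
    dPotential_orbit_antisymm hφ x ξ η]
  ring

lemma twoCocycle_zero_left (hφ : IsBgPotential I J B φ) (x : P) (ξ : GroupLieAlgebra I H) :
    twoCocycle I φ (0 : GroupLieAlgebra I H) ξ ((1 : H), x) = 0 := by
  refine (twoCocycle_apply hφ.smooth x (0 : GroupLieAlgebra I H) ξ).trans ?_
  have h0 : dPotential I J φ x (orbitDeriv I H J x (0 : E)) = 0 := by simp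
  have h : dPotential I J φ x (orbitDeriv I H J x (0 : E)) ξ = 0 := DFunLike.congr_fun h0 ξ
  exact (congrArg₂ (fun s t : ℝ => -s - t) h (apply_bracket_zero_left _ ξ)).trans (by simp)

lemma twoCocycle_zero_right (hφ : IsBgPotential I J B φ) (x : P) (ξ : GroupLieAlgebra I H) :
    twoCocycle I φ ξ (0 : GroupLieAlgebra I H) ((1 : H), x) = 0 := by
  rw [twoCocycle_antisymm hφ, twoCocycle_zero_left hφ, neg_zero]

variable [J.Boundaryless] [FiniteDimensional ℝ F]

section

variable (hB_inv : ∀ h : H, pullback (I.prod J) (I.prod J) (diagAct h : H × P → H × P) B = B)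
  (hφ : IsBgPotential I J B φ) {ωP : DiffForm J P 2}
  (hB : ∀ (g : H) (x : P), pullback J (I.prod J) (fun y : P => (g, y)) B x = -ωP x)
include hB_inv hφ hB

theorem shiftedForm_formula (g : H) (ν : LieDual I H) (x : P) (w w' : E × ((E →L[ℝ] ℝ) × F)) :
    (shiftedForm I J B φ (g, (ν, x)) : (E × ((E →L[ℝ] ℝ) × F)) [⋀^Fin 2]→L[ℝ] ℝ) ![w, w']
      = w'.2.1 (leftTangentInv I g w.1) - w.2.1 (leftTangentInv I g w'.1)
        + ν (⁅leftTangentInv I g w.1, leftTangentInv I g w'.1⁆ : GroupLieAlgebra I H)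
        - twoCocycle I φ (leftTangentInv I g w.1) (leftTangentInv I g w'.1) ((1 : H), x)
        + (ωP x : F [⋀^Fin 2]→L[ℝ] ℝ) ![w.2.2, w'.2.2] := by
  refine (shiftedForm_apply hB_inv hφ.smooth (g, (ν, x)) ![w, w']).trans ?_
  have e : (fun i => ((leftTangentInv I g ((![w, w'] : Fin 2 → E × ((E →L[ℝ] ℝ) × F)) i).1,
      ((![w, w'] : Fin 2 → E × ((E →L[ℝ] ℝ) × F)) i).2) : E × ((E →L[ℝ] ℝ) × F)))
      = ![(leftTangentInv I g w.1, w.2), (leftTangentInv I g w'.1, w'.2)] := by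
    funext i
    fin_cases i <;> rfl
  exact (congrArg (shiftedForm I J B φ ((1 : H), (ν, x))) e).trans
    (shiftedForm_one_apply hφ hB ν x _ _)

/-- The first of three test directions. This one and the next two isolate the `P`-component, the
group component and, once the latter is known, the dual component of `w`. -/
lemma shiftedForm_apply_base (g : H) (ν : LieDual I H) (x : P) (w : E × ((E →L[ℝ] ℝ) × F))
    (u : F) :
    (shiftedForm I J B φ (g, (ν, x)) : (E × ((E →L[ℝ] ℝ) × F)) [⋀^Fin 2]→L[ℝ] ℝ)
      ![w, (0, (0, u))] = (ωP x : F [⋀^Fin 2]→L[ℝ] ℝ) ![w.2.2, u] := by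
  refine (shiftedForm_formula hB_inv hφ hB g ν x w (0, (0, u))).trans ?_
  have h₀ : (0 : E →L[ℝ] ℝ) (leftTangentInv I g w.1) = 0 := rfl
  have e : leftTangentInv I g (0 : E) = (0 : GroupLieAlgebra I H) := map_zero _
  have h₁ : w.2.1 (leftTangentInv I g (0 : E)) = 0 := (congrArg w.2.1 e).trans (map_zero _)
  have h₂ := (congrArg (fun η : GroupLieAlgebra I H =>
    ν (⁅leftTangentInv I g w.1, η⁆ : GroupLieAlgebra I H)) e).trans (apply_bracket_zero_right ν _)
  have h₃ := (congrArg (fun η : GroupLieAlgebra I H =>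
    twoCocycle I φ (leftTangentInv I g w.1) η ((1 : H), x)) e).trans (twoCocycle_zero_right hφ x _)
  exact (congrArg₂ (· + ·) (congrArg₂ (· - ·) (congrArg₂ (· + ·) (congrArg₂ (· - ·) h₀ h₁) h₂) h₃)
    (Eq.refl ((ωP x : F [⋀^Fin 2]→L[ℝ] ℝ) ![w.2.2, u]))).trans (by simp)

lemma shiftedForm_apply_dual (g : H) (ν : LieDual I H) (x : P) (w : E × ((E →L[ℝ] ℝ) × F))
    (ρ : E →L[ℝ] ℝ) :
    (shiftedForm I J B φ (g, (ν, x)) : (E × ((E →L[ℝ] ℝ) × F)) [⋀^Fin 2]→L[ℝ] ℝ)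
      ![w, (0, (ρ, 0))] = ρ (leftTangentInv I g w.1) := by
  refine (shiftedForm_formula hB_inv hφ hB g ν x w (0, (ρ, 0))).trans ?_
  have e : leftTangentInv I g (0 : E) = (0 : GroupLieAlgebra I H) := map_zero _
  have h₁ : w.2.1 (leftTangentInv I g (0 : E)) = 0 := (congrArg w.2.1 e).trans (map_zero _)
  have h₂ := (congrArg (fun η : GroupLieAlgebra I H =>
    ν (⁅leftTangentInv I g w.1, η⁆ : GroupLieAlgebra I H)) e).trans (apply_bracket_zero_right ν _)
  have h₃ := (congrArg (fun η : GroupLieAlgebra I H =>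
    twoCocycle I φ (leftTangentInv I g w.1) η ((1 : H), x)) e).trans (twoCocycle_zero_right hφ x _)
  exact (congrArg₂ (· + ·) (congrArg₂ (· - ·) (congrArg₂ (· + ·) (congrArg₂ (· - ·) (Eq.refl (ρ (leftTangentInv I g w.1))) h₁) h₂) h₃)
    (alternating_zero_right (V := F) (ωP x) w.2.2)).trans (by simp)

lemma shiftedForm_apply_group (g : H) (ν : LieDual I H) (x : P) (w : E × ((E →L[ℝ] ℝ) × F))
    (ξ : GroupLieAlgebra I H) :
    (shiftedForm I J B φ (g, (ν, x)) : (E × ((E →L[ℝ] ℝ) × F)) [⋀^Fin 2]→L[ℝ] ℝ)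
      ![w, (leftTangent I g ξ, (0, 0))]
      = -w.2.1 ξ + ν (⁅leftTangentInv I g w.1, ξ⁆ : GroupLieAlgebra I H)
        - twoCocycle I φ (leftTangentInv I g w.1) ξ ((1 : H), x) := by
  refine (shiftedForm_formula hB_inv hφ hB g ν x w (leftTangent I g ξ, (0, 0))).trans ?_
  have h₀ : (0 : E →L[ℝ] ℝ) (leftTangentInv I g w.1) = 0 := rfl
  have e : leftTangentInv I g (leftTangent I g ξ) = ξ := leftTangentInv_comp_leftTangent g ξ
  have h₁ := congrArg w.2.1 e
  have h₂ := congrArg (fun η : GroupLieAlgebra I H =>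
    ν (⁅leftTangentInv I g w.1, η⁆ : GroupLieAlgebra I H)) e
  have h₃ := congrArg (fun η : GroupLieAlgebra I H =>
    twoCocycle I φ (leftTangentInv I g w.1) η ((1 : H), x)) e
  exact (congrArg₂ (· + ·) (congrArg₂ (· - ·) (congrArg₂ (· + ·) (congrArg₂ (· - ·) h₀ h₁) h₂) h₃)
    (alternating_zero_right (V := F) (ωP x) w.2.2)).trans (by simp)

theorem isSymplectic_shiftedForm (hωP : IsSymplectic J ωP) (hBs : IsSmoothForm (I.prod J) B)
    (hBc : ∀ z, extD (I.prod J) B z = 0) :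
    IsSymplectic (bodyModel I J) (shiftedForm I J B φ) where
  smooth := isSmoothForm_iff.2 (smoothFormAt_shiftedForm hBs hφ.smooth)
  closed := extD_shiftedForm hBs hBc hφ.smooth
  nondegenerate := by
    rintro ⟨g, ν, x⟩ v hv
    let w : E × ((E →L[ℝ] ℝ) × F) := v
    have h1 : w.2.2 = 0 := hωP.nondegenerate x w.2.2 fun u =>
      (shiftedForm_apply_base hB_inv hφ hB g ν x w u).symm.trans (hv _)
    have h2 : leftTangentInv I g w.1 = (0 : E) := eq_zero_of_forall_dual (V := E) fun ρ =>
      (shiftedForm_apply_dual hB_inv hφ hB g ν x w ρ).symm.trans (hv _)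
    have h3 : w.1 = 0 := (leftTangent_comp_leftTangentInv g w.1).symm.trans
      ((congrArg (leftTangent I g) h2).trans (map_zero _))
    -- With a vanishing group component, the bracket and cocycle terms drop out of the test against
    -- group directions.
    have h4 : w.2.1 = 0 := by
      refine ContinuousLinearMap.ext fun ξ => ?_
      have h := (shiftedForm_apply_group hB_inv hφ hB g ν x w ξ).symm.trans (hv _)
      have e1 := (congrArg (fun η : GroupLieAlgebra I H => ν (⁅η, ξ⁆ : GroupLieAlgebra I H)) h2).trans
        (apply_bracket_zero_left ν ξ)
      have e2 := (congrArg (fun η : GroupLieAlgebra I H => twoCocycle I φ η ξ ((1 : H), x)) h2).trans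
        (twoCocycle_zero_left hφ x ξ)
      have e3 := (congrArg₂ (fun s t : ℝ => -w.2.1 ξ + s - t) e1 e2).symm.trans h
      simpa using e3
    exact Prod.ext h3 (Prod.ext h4 h1)

theorem isInducedBracket_naturalBracket (hωP : IsSymplectic J ωP)
    (hBs : IsSmoothForm (I.prod J) B) (hBc : ∀ z, extD (I.prod J) B z = 0) :
    IsInducedBracket I J (shiftedForm I J B φ) (naturalBracket I J ωP φ) := by
  intro f k hf hk
  have hS := isSymplectic_shiftedForm hB_inv hφ hB hωP hBs hBc
  funext z
  obtain ⟨g, ν, x⟩ := z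
  let K : H × (LieDual I H × P) → ℝ :=
    k ∘ (Prod.snd : H × (LieDual I H × P) → LieDual I H × P)
  let w : E × ((E →L[ℝ] ℝ) × F) := hamVec (bodyModel I J) (shiftedForm I J B φ) K (g, (ν, x))
  have hw (v : E × ((E →L[ℝ] ℝ) × F)) :
      (shiftedForm I J B φ (g, (ν, x)) : (E × ((E →L[ℝ] ℝ) × F)) [⋀^Fin 2]→L[ℝ] ℝ) ![w, v]
        = fderiv ℝ (fun μ => k (μ, x)) ν v.2.1 + mvfderiv J (fun y => k (ν, y)) x v.2.2 :=
    (hamVec_spec hS K (g, (ν, x)) v).trans (mvfderiv_comp_snd hk g ν x v)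
  let δf : GroupLieAlgebra I H := funDeriv I (fun μ => f (μ, x)) ν
  let δk : GroupLieAlgebra I H := funDeriv I (fun μ => k (μ, x)) ν
  have h1 : w.2.2 = hamVec J ωP (fun y => k (ν, y)) x := by
    refine hamVec_unique hωP _ x w.2.2 fun u => ?_
    refine (shiftedForm_apply_base hB_inv hφ hB g ν x w u).symm.trans ((hw _).trans ?_)
    exact (congrArg (fun t : ℝ => t + mvfderiv J (fun y => k (ν, y)) x u)
      (map_zero (fderiv ℝ (fun μ => k (μ, x)) ν))).trans (zero_add _)
  have h2 : leftTangentInv I g w.1 = δk := by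
    refine sub_eq_zero.1 (eq_zero_of_forall_dual (V := E) fun ρ => ?_)
    have e := (shiftedForm_apply_dual hB_inv hφ hB g ν x w ρ).symm.trans (hw _)
    have e2 : mvfderiv J (fun y => k (ν, y)) x (0 : F) = 0 := map_zero _
    have e3 : ρ δk = fderiv ℝ (fun μ => k (μ, x)) ν ρ :=
      funDeriv_spec (I := I) (H := H) (fun μ => k (μ, x)) ν ρ
    have e4 : ρ (leftTangentInv I g w.1) = ρ δk :=
      e.trans ((congrArg (fun t : ℝ => fderiv ℝ (fun μ => k (μ, x)) ν ρ + t) e2).trans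
        ((add_zero _).trans e3.symm))
    exact (map_sub ρ _ _).trans (sub_eq_zero.2 e4)
  -- The dual component of the Hamiltonian vector enters the bracket only through its pairing with
  -- `δf`, so the single direction `δf` suffices. The right side is zero because `k ∘ π` does not
  -- depend on the group variable.
  have h3 : -w.2.1 δf + ν (⁅δk, δf⁆ : GroupLieAlgebra I H) - twoCocycle I φ δk δf ((1 : H), x)
      = 0 := by
    have e := (shiftedForm_apply_group hB_inv hφ hB g ν x w δf).symm.trans (hw _)
    have e2 : mvfderiv J (fun y => k (ν, y)) x (0 : F) = 0 := map_zero _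
    have e3 : fderiv ℝ (fun μ => k (μ, x)) ν 0 = 0 := map_zero _
    rw [h2] at e
    exact e.trans ((congrArg₂ (· + ·) e3 e2).trans (add_zero 0))
  have h4 : poissonBracket (bodyModel I J) (shiftedForm I J B φ)
      (f ∘ (Prod.snd : H × (LieDual I H × P) → LieDual I H × P)) K (g, (ν, x))
      = w.2.1 δf + mvfderiv J (fun y => f (ν, y)) x w.2.2 := by
    refine (mvfderiv_comp_snd hf g ν x w).trans ?_
    exact congrArg (· + mvfderiv J (fun y => f (ν, y)) x w.2.2)
      (funDeriv_spec (I := I) (H := H) (fun μ => f (μ, x)) ν w.2.1).symm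
  have h5 : mvfderiv J (fun y => f (ν, y)) x w.2.2
      = poissonBracket J ωP (fun y => f (ν, y)) (fun y => k (ν, y)) x :=
    congrArg (mvfderiv J (fun y => f (ν, y)) x) h1
  refine Eq.trans ?_ h4.symm
  have h6 := apply_bracket_skew ν δk δf
  have h7 := twoCocycle_antisymm hφ x δk δf
  rw [h5]
  change -ν (⁅δf, δk⁆ : GroupLieAlgebra I H)
    + poissonBracket J ωP (fun y => f (ν, y)) (fun y => k (ν, y)) x
    + twoCocycle I φ δf δk ((1 : H), x) = _
  linarith

end

end Bracket

end BodyReduction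

end

theorem mainTheorem3
    {E : Type*} [NormedAddCommGroup E] [NormedSpace ℝ E] [FiniteDimensional ℝ E]
    {X : Type*} [TopologicalSpace X] (I : ModelWithCorners ℝ E X) [I.Boundaryless]
    {H : Type*} [TopologicalSpace H] [ChartedSpace X H] [Group H] [LieGroup I ∞ H]
    {F : Type*} [NormedAddCommGroup F] [NormedSpace ℝ F] [FiniteDimensional ℝ F]
    {Y : Type*} [TopologicalSpace Y] (J : ModelWithCorners ℝ F Y) [J.Boundaryless]
    {P : Type*} [TopologicalSpace P] [ChartedSpace Y P] [IsManifold J ∞ P]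
    [MulAction H P] [ContMDiffSMul I J ∞ H P]
    -- the symplectic form of `P`, preserved by the action of `H`
    (ωP : BodyReduction.DiffForm J P 2) (hωP : BodyReduction.IsSymplectic J ωP)
    (hωP_inv : ∀ h : H, BodyReduction.pullback J J (fun x : P => h • x) ωP = ωP)
    -- the closed invariant two-form `B` on `H × P`, with restriction `-ωP` to `P`
    (B : BodyReduction.DiffForm (I.prod J) (H × P) 2)
    (hB_smooth : BodyReduction.IsSmoothForm (I.prod J) B)
    (hB_closed : ∀ z, BodyReduction.extD (I.prod J) B z = 0)
    (hB_restrict : ∀ (g : H) (x : P),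
      BodyReduction.pullback J (I.prod J) (fun y : P => (g, y)) B x = -ωP x)
    (hB_inv : ∀ h : H, BodyReduction.pullback (I.prod J) (I.prod J)
      (BodyReduction.diagAct h : H × P → H × P) B = B)
    -- the potential of `B`
    (φ : H × P → BodyReduction.LieDual I H) (hφ : BodyReduction.IsBgPotential I J B φ) :
    BodyReduction.IsSymplectic (BodyReduction.bodyModel I J)
        (BodyReduction.shiftedForm I J B φ) ∧
      (∀ h : H, BodyReduction.pullback (BodyReduction.bodyModel I J) (BodyReduction.bodyModel I J)
        (BodyReduction.bodyAct I h : H × (BodyReduction.LieDual I H × P) → _)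
        (BodyReduction.shiftedForm I J B φ) = BodyReduction.shiftedForm I J B φ) ∧
      BodyReduction.IsInducedBracket I J (BodyReduction.shiftedForm I J B φ)
        (BodyReduction.naturalBracket I J ωP φ) := by
  exact ⟨BodyReduction.isSymplectic_shiftedForm hB_inv hφ hB_restrict hωP hB_smooth hB_closed,
    fun h => BodyReduction.shiftedForm_invariant hB_inv hφ.smooth h,
    BodyReduction.isInducedBracket_naturalBracket hB_inv hφ hB_restrict hωP hB_smooth hB_closed⟩
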